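/- Let $\mathbb M$ be a saturated model of a complete first-order (possibly many-sorted) theory, let $A\subset\mathbb M$ with $|A|<|\mathbb M|$, and let $p$ be a complete type over $A$ in finitely many variables, with set of realizations $p(\mathbb M)$. A relation on (or between) sets of tuples of $\mathbb M$ is called relatively $B$-definable if it is the trace there of a $B$-definable set. Let $<_p$ be a linear order on $p(\mathbb M)$ such that $(p,<_p)$ is a weakly o-minimal pair over $A$: the order $<_p$ is relatively $A$-definable, and every subset of $p(\mathbb M)$ that is relatively definable with parameters from $\mathbb M$ has finitely many convex components in $(p(\mathbb M),<_p)$. Let $(D,<)$ be an $A$-definable linear order ($D$ a set of finite tuples), and let $f:p(\mathbb M)\to D$ be a non-constant function whose graph is relatively $A$-definable. For an equivalence relation $E$ on $p(\mathbb M)$, write $[x_1]_E<_p[x_2]_E$ if every element of $[x_1]_E$ is $<_p$-below every element of $[x_2]_E$; $E$ is convex if all its classes are convex. Then: (i) (Local monotonicity) There is a convex, relatively $A$-definable equivalence relation $E$ on $p(\mathbb M)$, $E\neq\mathrm{id}_{p(\mathbb M)}$, such that the restriction of $f$ to each $E$-class is constant, strictly increasing or strictly decreasing with respect to $<_p$ and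 $<$. (ii) (Upper monotonicity) There is a convex, relatively $A$-definable equivalence relation $E$ on $p(\mathbb M)$, $E\neq p(\mathbb M)^2$, such that one of the following two conditions holds for all $x_1,x_2\in p(\mathbb M)$: $$[x_1]_E<_p[x_2]_E\Rightarrow f(x_1)<f(x_2)\qquad\text{or}\qquad [x_1]_E<_p[x_2]_E\Rightarrow f(x_1)>f(x_2).$$ Moreover, for this $E$ the relation $f(E)=\{(f(x),f(y)) : (x,y)\in E\}$ is a convex equivalence relation on $(f(p(\mathbb M)),<)$, and $f_E([x]_E)=[f(x)]_{f(E)}$ gives a well-defined map $f_E:p(\mathbb M)/E\to f(p(\mathbb M))/f(E)$ that is strictly increasing, respectively strictly decreasing, for the induced orders on the quotients. -/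

import Mathlib

open Cardinal

universe u v w x

/-! Many-sorted first-order logic with equality. A one-sorted language is the case where the type
of sorts has exactly one element. -/

/-- A many-sorted first-order language. Function symbols have a finite sequence of argument sorts
and a value sort (constants are the function symbols with no argument), relation symbols have a
finite sequence of argument sorts. -/
structure MSLanguage where
  Sorts : Type u
  Functions : {n : ℕ} → (Fin n → Sorts) → Sorts → Type v
  Relations : {n : ℕ} → (Fin n → Sorts) → Type w

namespace MSLanguage

variable {L : MSLanguage.{u, v, w}}

/-- Terms of sort `s` in free variables indexed by `ι`, the variable `i` having sort `σ i`. -/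
inductive Term (L : MSLanguage.{u, v, w}) {ι : Type} (σ : ι → L.Sorts) :
    L.Sorts → Type (max u v)
  | var (i : ι) : Term L σ (σ i)
  | func {n : ℕ} {τ : Fin n → L.Sorts} {s : L.Sorts} (F : L.Functions τ s)
      (ts : ∀ i, Term L σ (τ i)) : Term L σ s

/-- The context `σ` extended by one new variable of sort `s`, whose index is `none`. -/
def extend {ι : Type} (s : L.Sorts) (σ : ι → L.Sorts) : Option ι → L.Sorts
  | none => s
  | some i => σ i

/-- First-order formulas whose free variables are among those indexed by `ι`, the variable `i`
having sort `σ i`. In `all φ` the variable `none` of `φ` is bound. -/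
inductive Formula (L : MSLanguage.{u, v, w}) :
    {ι : Type} → (ι → L.Sorts) → Type (max 1 u v w)
  | falsum {ι : Type} {σ : ι → L.Sorts} : Formula L σ
  | equal {ι : Type} {σ : ι → L.Sorts} {s : L.Sorts} (t₁ t₂ : L.Term σ s) : Formula L σ
  | rel {ι : Type} {σ : ι → L.Sorts} {n : ℕ} {τ : Fin n → L.Sorts} (R : L.Relations τ)
      (ts : ∀ i, L.Term σ (τ i)) : Formula L σ
  | imp {ι : Type} {σ : ι → L.Sorts} (φ ψ : Formula L σ) : Formula L σ
  | all {ι : Type} {σ : ι → L.Sorts} {s : L.Sorts} (φ : Formula L (extend s σ)) : Formula L σ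

/-- The negation of a formula. -/
def Formula.not {ι : Type} {σ : ι → L.Sorts} (φ : L.Formula σ) : L.Formula σ :=
  Formula.imp φ Formula.falsum

/-- An `L`-structure whose universe of sort `s` is `M s`. -/
class Structure (L : MSLanguage.{u, v, w}) (M : L.Sorts → Type x) where
  funMap : ∀ {n : ℕ} {τ : Fin n → L.Sorts} {s : L.Sorts},
    L.Functions τ s → (∀ i, M (τ i)) → M s
  relMap : ∀ {n : ℕ} {τ : Fin n → L.Sorts}, L.Relations τ → (∀ i, M (τ i)) → Prop

/-- `M ^ σ`: the tuples of elements of `M` whose coordinate at `i` has sort `σ i`. -/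
abbrev Tuple (M : L.Sorts → Type x) {ι : Type} (σ : ι → L.Sorts) : Type x :=
  ∀ i, M (σ i)

section Semantics

variable {M : L.Sorts → Type x} {ι κ : Type} {σ : ι → L.Sorts} {τ : κ → L.Sorts}

/-- The tuple `c, v` for the context extended by one variable. -/
def extendTuple {s : L.Sorts} (c : M s) (v : Tuple M σ) : Tuple M (extend s σ)
  | none => c
  | some i => v i

/-- The concatenation of two tuples. -/
def pair (a : Tuple M σ) (b : Tuple M τ) : Tuple M (Sum.elim σ τ)
  | Sum.inl i => a i
  | Sum.inr j => b j

/-- The value of a term. -/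
def Term.eval [L.Structure M] (v : Tuple M σ) : {s : L.Sorts} → L.Term σ s → M s
  | _, .var i => v i
  | _, .func F ts => Structure.funMap F (fun i => (ts i).eval v)

/-- Satisfaction of a formula (Tarski's definition). -/
def Formula.Holds [L.Structure M] : {ι : Type} → {σ : ι → L.Sorts} → L.Formula σ →
    Tuple M σ → Prop
  | _, _, .falsum, _ => False
  | _, _, .equal t₁ t₂, v => t₁.eval v = t₂.eval v
  | _, _, .rel R ts, v => Structure.relMap R (fun i => (ts i).eval v)
  | _, _, .imp φ ψ, v => φ.Holds v → ψ.Holds v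
  | _, _, .all (s := s) φ, v => ∀ c : M s, φ.Holds (extendTuple c v)

end Semantics

/-- `L_A`-formulas in free variables of sorts `σ`: formulas with finitely many parameters from the
set `A` of elements of `M`. -/
structure FormulaOver {M : L.Sorts → Type x} (A : Set (Σ s, M s)) {ι : Type}
    (σ : ι → L.Sorts) where
  k : ℕ
  paramSort : Fin k → L.Sorts
  param : Tuple M paramSort
  param_mem : ∀ j, (⟨paramSort j, param j⟩ : Σ s, M s) ∈ A
  formula : L.Formula (Sum.elim σ paramSort)

section Definability

variable {M : L.Sorts → Type x} [L.Structure M] {A : Set (Σ s, M s)}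
  {ι κ : Type} {σ : ι → L.Sorts} {τ : κ → L.Sorts}

/-- `a` satisfies the `L_A`-formula `φ`. -/
def FormulaOver.Holds (φ : FormulaOver A σ) (a : Tuple M σ) : Prop :=
  φ.formula.Holds (pair a φ.param)

/-- The negation of an `L_A`-formula. -/
def FormulaOver.not (φ : FormulaOver A σ) : FormulaOver A σ :=
  { φ with formula := φ.formula.not }

/-- A set of `L_A`-formulas each finite part of which is satisfied in `M`. -/
def FinitelySatisfiable (Φ : Set (FormulaOver A σ)) : Prop :=
  ∀ Δ : Set (FormulaOver A σ), Δ.Finite → Δ ⊆ Φ → ∃ a : Tuple M σ, ∀ φ ∈ Δ, φ.Holds a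

/-- `A`-definable subsets of `M ^ σ`. -/
def IsDefinable (A : Set (Σ s, M s)) (D : Set (Tuple M σ)) : Prop :=
  ∃ φ : FormulaOver A σ, ∀ a, a ∈ D ↔ φ.Holds a

/-- Relatively `B`-definable subsets of `P`: the traces on `P` of `B`-definable sets. -/
def IsRelDefinable (B : Set (Σ s, M s)) {P : Set (Tuple M σ)} (X : Set P) : Prop :=
  ∃ D : Set (Tuple M σ), IsDefinable B D ∧ ∀ a : P, a ∈ X ↔ a.1 ∈ D

/-- Relatively `B`-definable relations between elements of `P` and elements of `Q`: the traces on
`P × Q` of `B`-definable sets. -/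
def IsRelDefinable₂ (B : Set (Σ s, M s)) {P : Set (Tuple M σ)} {Q : Set (Tuple M τ)}
    (R : P → Q → Prop) : Prop :=
  ∃ D : Set (Tuple M (Sum.elim σ τ)), IsDefinable B D ∧
    ∀ (a : P) (b : Q), R a b ↔ pair a.1 b.1 ∈ D

/-- `M` is saturated: every finitely satisfiable set of formulas in one variable, with parameters
from a set of cardinality less than that of `M`, is realized in `M`. -/
def IsSaturated (M : L.Sorts → Type x) [L.Structure M] : Prop :=
  ∀ B : Set (Σ s, M s), #B < #(Σ s, M s) →
    ∀ (s : L.Sorts) (Φ : Set (FormulaOver B (fun _ : Unit => s))),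
      FinitelySatisfiable Φ → ∃ a : Tuple M (fun _ : Unit => s), ∀ φ ∈ Φ, φ.Holds a

/-- Complete types over `A` in variables of sorts `σ`, relative to the theory of `M`. -/
structure CompleteType (A : Set (Σ s, M s)) (σ : ι → L.Sorts) where
  carrier : Set (FormulaOver A σ)
  finitelySatisfiable : FinitelySatisfiable carrier
  complete : ∀ φ : FormulaOver A σ, φ ∈ carrier ∨ φ.not ∈ carrier

/-- The set `p(M)` of realizations of the type `p`. -/
def CompleteType.locus (p : CompleteType A σ) : Set (Tuple M σ) :=
  {a | ∀ φ ∈ p.carrier, φ.Holds a}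

end Definability

end MSLanguage

/-! Linear orders and convex equivalence relations. -/

/-- The convex components of `S`: its maximal convex subsets. -/
def convexComponents {X : Type*} [LinearOrder X] (S : Set X) : Set (Set X) :=
  {C | Maximal (fun C' : Set X => C' ⊆ S ∧ C'.OrdConnected) C}

/-- An equivalence relation all of whose classes are convex. -/
def IsConvexEquiv {X : Type*} [LinearOrder X] (E : Setoid X) : Prop :=
  ∀ a : X, {b : X | E a b}.OrdConnected

/-- The order between classes of an equivalence relation: `C < C'` when every element of the class
`C` is smaller than every element of the class `C'`. -/
def ClassLT {X : Type*} [LinearOrder X] (E : Setoid X) (C C' : Quotient E) : Prop :=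
  ∀ a b : X, Quotient.mk E a = C → Quotient.mk E b = C' → a < b

/-- The image of an equivalence relation `E` under `f`, as a relation on the image of `f`. -/
def imageRel {X Y : Type*} (f : X → Y) (E : Setoid X) (y z : Set.range f) : Prop :=
  ∃ a b : X, E a b ∧ f a = y ∧ f b = z

namespace MSLanguage

variable {L : MSLanguage.{u, v, w}} {M : L.Sorts → Type x} [L.Structure M]
  {A : Set (Σ s, M s)} {ι : Type} {σ : ι → L.Sorts}

/-- `(p, <)` is a weakly o-minimal pair over `A`: the linear order `<` on `p(M)` is relatively
`A`-definable, and every subset of `p(M)` which is relatively definable (with any parameters from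
`M`) has finitely many convex components. -/
def IsWeaklyOMinimalPair (p : CompleteType A σ) [LinearOrder p.locus] : Prop :=
  IsRelDefinable₂ A (fun a b : p.locus => a < b) ∧
    ∀ S : Set p.locus, IsRelDefinable (Set.univ : Set (Σ s, M s)) S →
      (convexComponents S).Finite

end MSLanguage

/-! Homogeneous families of relations on a linear order. -/

/-! Write `X` for the locus of `p`. Two facts about `X` carry the proof. Homogeneity: since the
model is saturated, its automorphisms fixing `A` act transitively on `X`, and they preserve every
relatively `A`-definable relation. Tameness: the fibres of these relations have finitely many convex
components. `IsHomogeneousFamily` isolates these facts, together with closure under Boolean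
operations, reversal and strict bounds of fibres; the rest is combinatorics of the order `X`.

Since `X` is only type-definable, quantifiers over `X` do not preserve relative definability; strict
bounds of fibres replace them. The strict upper bounds of a set `S` with finitely many components
either fill `X` or are the points outside `S` beyond some `s` (`strictUpperBounds_eq`), so a fibre
over `a` of the bound relation is definable from `a` and `s`. That relation is invariant under
automorphisms, and compactness then removes both parameters (`isRelDefinable₂_of_invariant`).

Local monotonicity: to the right of a point `x`, the value of `f` stays above, below or equal to `f
x`. In the first case the same holds at every point. Let `N w` consist of the `x < w` with `f x < f
z` for all `z` in `(x, w]`. On an interval inside `N w` the map `f` increases. If there is no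
nontrivial such interval, `N w` is finite, of size independent of `w`; but moving `w` down to just
above a point beyond all of `N w` gains an element, a contradiction. The relation `E` says that the
behaviour found persists throughout the interval between two points.

Upper monotonicity: by homogeneity a non-constant `f` is not eventually equal to `f x`, so up to
reversing the target some `f x` is eventually below `f z`. Two points are identified when the same
points have `f`-value below all values on the final segments starting at them. A failure of
monotonicity across classes is a defect. The defects of `w` meet finitely many classes, and their
number is independent of `w`; but if there were a defect, some `w₂ < w` would have all defects of
`w` and one more in a new class (`not_defect`). -/

theorem exists_finite_representatives {X : Type*} [LinearOrder X] {S : Set X}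
    (hS : (convexComponents S).Finite) :
    ∃ T : Set X, T.Finite ∧ T ⊆ S ∧ ∀ y ∈ S, ∃ t ∈ T, Set.uIcc t y ⊆ S := by
  have hsub : S.ordConnectedComponent '' S ⊆ convexComponents S := by
    rintro _ ⟨a, ha, rfl⟩
    refine ⟨⟨Set.ordConnectedComponent_subset, inferInstance⟩, ?_⟩
    rintro C ⟨hC, hC'⟩ hle y hy
    exact (hC'.uIcc_subset (hle (Set.self_mem_ordConnectedComponent.2 ha)) hy).trans hC
  obtain ⟨T, hTS, hbij⟩ :=
    Set.exists_subset_bijOn S S.ordConnectedComponent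
  refine ⟨T, ?_, hTS, fun y hy => ?_⟩
  · exact hbij.finite_iff_finite.2 (hS.subset hsub)
  · obtain ⟨t, ht, hty⟩ := hbij.surjOn ⟨y, hy, rfl⟩
    refine ⟨t, ht, ?_⟩
    have : y ∈ S.ordConnectedComponent y := Set.self_mem_ordConnectedComponent.2 hy
    rw [← hty] at this
    exact this

/-- Take for `s` the largest of the finitely many component representatives: a later point `y` of
`S` shares a component with some representative `t ≤ s`, and that component contains all of `[s,
y]`. -/
theorem exists_last_component {X : Type*} [LinearOrder X] {S : Set X}
    (hS : (convexComponents S).Finite) (hne : S.Nonempty) :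
    ∃ s ∈ S, ∀ y ∈ S, s ≤ y → Set.Icc s y ⊆ S := by
  obtain ⟨T, hT, hTS, hrep⟩ := exists_finite_representatives hS
  obtain ⟨y₀, hy₀⟩ := hne
  obtain ⟨t₀, ht₀, -⟩ := hrep y₀ hy₀
  obtain ⟨s, hs, hmax⟩ := hT.exists_maximalFor id T ⟨t₀, ht₀⟩
  refine ⟨s, hTS hs, fun y hy hsy => ?_⟩
  obtain ⟨t, ht, hty⟩ := hrep y hy
  have hts : t ≤ s := (le_total t s).elim id fun h => hmax ht h
  exact fun z hz => hty (Set.Icc_subset_uIcc ⟨hts.trans hz.1, hz.2⟩)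

theorem exists_first_component {X : Type*} [LinearOrder X] {S : Set X}
    (hS : (convexComponents S).Finite) (hne : S.Nonempty) :
    ∃ s ∈ S, ∀ y ∈ S, y ≤ s → Set.Icc y s ⊆ S := by
  obtain ⟨T, hT, hTS, hrep⟩ := exists_finite_representatives hS
  obtain ⟨y₀, hy₀⟩ := hne
  obtain ⟨t₀, ht₀, -⟩ := hrep y₀ hy₀
  obtain ⟨s, hs, hmin⟩ := hT.exists_minimalFor id T ⟨t₀, ht₀⟩
  refine ⟨s, hTS hs, fun y hy hsy => ?_⟩
  obtain ⟨t, ht, hty⟩ := hrep y hy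
  have hts : s ≤ t := (le_total s t).elim id fun h => hmin ht h
  exact fun z hz => hty (Set.Icc_subset_uIcc' ⟨hz.1, hz.2.trans hts⟩)

/-- The strict upper bounds of a set with finitely many convex components form a set defined from
that set by means of the order and at most one of its elements. -/
theorem strictUpperBounds_eq {X : Type*} [LinearOrder X] {S : Set X}
    (hS : (convexComponents S).Finite) :
    (∀ w, ∀ y ∈ S, y < w) ∨ ∃ s, ∀ w, (∀ y ∈ S, y < w) ↔ s < w ∧ w ∉ S := by
  rcases S.eq_empty_or_nonempty with rfl | hne
  · exact Or.inl fun _ _ h => h.elim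
  obtain ⟨s, hs, hlast⟩ := exists_last_component hS hne
  refine Or.inr ⟨s, fun w => ⟨fun h => ⟨h s hs, fun hw => lt_irrefl _ (h w hw)⟩, ?_⟩⟩
  rintro ⟨hsw, hw⟩ y hy
  by_contra! hwy
  exact hw (hlast y hy (hsw.le.trans hwy) ⟨hsw.le, hwy⟩)

theorem strictLowerBounds_eq {X : Type*} [LinearOrder X] {S : Set X}
    (hS : (convexComponents S).Finite) :
    (∀ w, ∀ y ∈ S, w < y) ∨ ∃ s, ∀ w, (∀ y ∈ S, w < y) ↔ w < s ∧ w ∉ S := by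
  rcases S.eq_empty_or_nonempty with rfl | hne
  · exact Or.inl fun _ _ h => h.elim
  obtain ⟨s, hs, hfirst⟩ := exists_first_component hS hne
  refine Or.inr ⟨s, fun w => ⟨fun h => ⟨h s hs, fun hw => lt_irrefl _ (h w hw)⟩, ?_⟩⟩
  rintro ⟨hsw, hw⟩ y hy
  by_contra! hwy
  exact hw (hfirst y hy (hwy.trans hsw.le) ⟨hwy, hsw.le⟩)

/-- Either the last component is a final segment, or some `w` above `s` escapes it, and then no
point of `S` can lie beyond `w`. -/
theorem eventually_mem_or_notMem {X : Type*} [LinearOrder X] [Nonempty X] {S : Set X}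
    (hS : (convexComponents S).Finite) :
    (∃ y, Set.Ici y ⊆ S) ∨ ∃ y, Set.Ici y ⊆ Sᶜ := by
  rcases S.eq_empty_or_nonempty with rfl | hne
  · exact Or.inr ⟨Classical.arbitrary X, by simp⟩
  obtain ⟨s, hs, hlast⟩ := exists_last_component hS hne
  by_cases h : Set.Ici s ⊆ S
  · exact Or.inl ⟨s, h⟩
  obtain ⟨w, hw, hwS⟩ := Set.not_subset.1 h
  exact Or.inr ⟨w, fun y hy hyS => hwS (hlast y hyS (le_trans hw hy) ⟨hw, hy⟩)⟩

theorem right_germ {X : Type*} [LinearOrder X] [NoMaxOrder X] {S : Set X} {x : X}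
    (hS : (convexComponents (S ∩ Set.Ioi x)).Finite) :
    (∃ y, x < y ∧ Set.Ioo x y ⊆ S) ∨ ∃ y, x < y ∧ Set.Ioo x y ⊆ Sᶜ := by
  rcases (S ∩ Set.Ioi x).eq_empty_or_nonempty with he | hne
  · obtain ⟨y, hy⟩ := exists_gt x
    exact Or.inr ⟨y, hy, fun z hz hzS => (he ▸ (⟨hzS, hz.1⟩ : z ∈ S ∩ Set.Ioi x) : z ∈ (∅ : Set X))⟩
  obtain ⟨s, hs, hfirst⟩ := exists_first_component hS hne
  by_cases h : Set.Ioo x s ⊆ S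
  · exact Or.inl ⟨s, hs.2, h⟩
  obtain ⟨w, hw, hwS⟩ := Set.not_subset.1 h
  exact Or.inr ⟨w, hw.1, fun y hy hyS =>
    hwS (hfirst y ⟨hyS, hy.1⟩ (hy.2.trans hw.2).le ⟨hy.2.le, hw.2.le⟩).1⟩

/-- A family of binary relations on a linear order which behaves like the relatively definable
relations on the locus of a weakly o-minimal type. -/
structure IsHomogeneousFamily {X : Type*} [LinearOrder X] (𝓡 : Set (X → X → Prop)) : Prop where
  not_mem : ∀ {R}, R ∈ 𝓡 → (fun a b => ¬ R a b) ∈ 𝓡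
  and_mem : ∀ {R S}, R ∈ 𝓡 → S ∈ 𝓡 → (fun a b => R a b ∧ S a b) ∈ 𝓡
  swap_mem : ∀ {R}, R ∈ 𝓡 → (fun a b => R b a) ∈ 𝓡
  lt_mem : (fun a b => a < b) ∈ 𝓡
  upper_mem : ∀ {R}, R ∈ 𝓡 → (fun a b => ∀ c, R a c → c < b) ∈ 𝓡
  lower_mem : ∀ {R}, R ∈ 𝓡 → (fun a b => ∀ c, R a c → b < c) ∈ 𝓡
  finite_components : ∀ {R}, R ∈ 𝓡 → ∀ a, (convexComponents {b | R a b}).Finite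
  exists_equiv : ∀ a b : X, ∃ g : X ≃ X, g a = b ∧ ∀ R ∈ 𝓡, ∀ c d, R c d ↔ R (g c) (g d)

namespace IsHomogeneousFamily

variable {X Y : Type*} [LinearOrder X] [LinearOrder Y] {𝓡 : Set (X → X → Prop)} {f : X → Y}

theorem or_mem (h : IsHomogeneousFamily 𝓡) {R S : X → X → Prop} (hR : R ∈ 𝓡) (hS : S ∈ 𝓡) :
    (fun a b => R a b ∨ S a b) ∈ 𝓡 := by
  have := h.not_mem (h.and_mem (h.not_mem hR) (h.not_mem hS))
  convert this using 3
  tauto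

theorem le_mem (h : IsHomogeneousFamily 𝓡) : (fun a b : X => a ≤ b) ∈ 𝓡 := by
  have := h.not_mem (h.swap_mem h.lt_mem)
  convert this using 3
  exact not_lt.symm

theorem of_exists (h : IsHomogeneousFamily 𝓡) {R : X → X → Prop} (hR : R ∈ 𝓡) {a : X}
    (ha : ∃ b, R a b) (c : X) : ∃ d, R c d := by
  obtain ⟨b, hb⟩ := ha
  obtain ⟨g, rfl, hg⟩ := h.exists_equiv a c
  exact ⟨g b, (hg R hR a b).1 hb⟩

theorem noMaxOrder (h : IsHomogeneousFamily 𝓡) [Nontrivial X] : NoMaxOrder X := by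
  obtain ⟨a, b, hab⟩ := exists_pair_lt X
  exact ⟨h.of_exists h.lt_mem ⟨b, hab⟩⟩

theorem noMinOrder (h : IsHomogeneousFamily 𝓡) [Nontrivial X] : NoMinOrder X := by
  obtain ⟨a, b, hab⟩ := exists_pair_lt X
  exact ⟨h.of_exists (h.swap_mem h.lt_mem) ⟨a, hab⟩⟩

end IsHomogeneousFamily

/-- `x` and `y` are related if the relation `r` holds between all `a < b` in the interval spanned by
`x` and `y`. -/
def intervalSetoid {X : Type*} [LinearOrder X] (r : X → X → Prop)
    (hr : ∀ a b c, r a b → r b c → r a c) : Setoid X where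
  r x y := ∀ a ∈ Set.uIcc x y, ∀ b ∈ Set.uIcc x y, a < b → r a b
  iseqv := by
    refine ⟨fun x a ha b hb hab => ?_, fun {x y} h => by rwa [Set.uIcc_comm], ?_⟩
    · rw [Set.uIcc_self] at ha hb
      rw [ha, hb] at hab
      exact (lt_irrefl _ hab).elim
    · intro x y z hxy hyz a ha b hb hab
      simp only [Set.mem_uIcc] at *
      rcases le_total y a with h1 | h1
      · rcases le_total x z with h | h
        · exact hyz a (by grind) b (by grind) hab
        · exact hxy a (by grind) b (by grind) hab
      rcases le_total b y with h2 | h2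
      · rcases le_total x z with h | h
        · exact hxy a (by grind) b (by grind) hab
        · exact hyz a (by grind) b (by grind) hab
      rcases h1.eq_or_lt with rfl | h1
      · rcases le_total x z with h | h
        · exact hyz a (by grind) b (by grind) hab
        · exact hxy a (by grind) b (by grind) hab
      rcases h2.eq_or_lt with rfl | h2
      · rcases le_total x z with h | h
        · exact hxy a (by grind) y (by grind) hab
        · exact hyz a (by grind) y (by grind) hab
      -- The only case that needs transitivity of `r`: here `y` lies strictly between `a` and `b`.
      rcases le_total x z with h | h
      · exact hr _ _ _ (hxy a (by grind) y (by grind) h1) (hyz y (by grind) b (by grind) h2)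
      · exact hr _ _ _ (hyz a (by grind) y (by grind) h1) (hxy y (by grind) b (by grind) h2)

theorem IsConvexEquiv.of_le {X : Type*} [LinearOrder X] {E : Setoid X}
    (h : ∀ a b c, a ≤ b → b ≤ c → E a c → E a b) : IsConvexEquiv E := by
  refine fun a => ⟨fun b hb c hc d hd => ?_⟩
  exact E.trans hb (h b d c hd.1 hd.2 (E.trans (E.symm hb) hc))

theorem IsConvexEquiv.left {X : Type*} [LinearOrder X] {E : Setoid X} (hE : IsConvexEquiv E)
    {a b c : X} (hab : a ≤ b) (hbc : b ≤ c) (h : E a c) : E a b :=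
  (hE a).out (E.refl a) h ⟨hab, hbc⟩

theorem IsConvexEquiv.right {X : Type*} [LinearOrder X] {E : Setoid X} (hE : IsConvexEquiv E)
    {a b c : X} (hab : a ≤ b) (hbc : b ≤ c) (h : E a c) : E b c :=
  E.trans (E.symm (hE.left hab hbc h)) h

/-! ### Convexity and definability of the interval equivalence relation. -/

section IntervalSetoid

variable {X : Type*} [LinearOrder X] {r : X → X → Prop} {hr : ∀ a b c, r a b → r b c → r a c}

theorem intervalSetoid_apply {x y : X} (hxy : x ≤ y) : intervalSetoid r hr x y ↔
    ∀ a ∈ Set.Icc x y, ∀ b ∈ Set.Icc x y, a < b → r a b := by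
  rw [← Set.uIcc_of_le hxy]
  rfl

theorem isConvexEquiv_intervalSetoid : IsConvexEquiv (intervalSetoid r hr) := by
  refine .of_le fun a b c hab hbc h => ?_
  rw [intervalSetoid_apply (hab.trans hbc)] at h
  rw [intervalSetoid_apply hab]
  exact fun x hx y hy => h x ⟨hx.1, hx.2.trans hbc⟩ y ⟨hy.1, hy.2.trans hbc⟩

theorem intervalSetoid_lt {a b c : X} (hb : intervalSetoid r hr a b)
    (hc : intervalSetoid r hr a c) (hbc : b < c) : r b c :=
  (intervalSetoid_apply hbc.le).1 ((intervalSetoid r hr).trans ((intervalSetoid r hr).symm hb) hc)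
    b (Set.left_mem_Icc.2 hbc.le) c (Set.right_mem_Icc.2 hbc.le) hbc

/-- The two nested quantifiers over `[x, y]` are turned into strict bounds. That `r c d` holds for
all `d` in `(c, y]` says that `y` is a strict lower bound of the later failures of `r c`; that this
is so for every `c` in `[x, y)` says that `x` is a strict upper bound of the exceptional `c < y`. -/
theorem IsHomogeneousFamily.intervalSetoid_mem {𝓡 : Set (X → X → Prop)}
    (h : IsHomogeneousFamily 𝓡) (hmem : r ∈ 𝓡) :
    (fun a b => intervalSetoid r hr a b) ∈ 𝓡 := by
  have h1 := h.lower_mem (h.and_mem h.lt_mem (h.not_mem hmem))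
  have h2 := h.upper_mem (h.and_mem (h.swap_mem h.lt_mem) (h.not_mem (h.swap_mem h1)))
  have h3 := h.or_mem (h.and_mem h.le_mem (h.swap_mem h2)) (h.and_mem (h.swap_mem h.le_mem) h2)
  have key : ∀ x y : X, x ≤ y → (intervalSetoid r hr x y ↔
      ∀ c, (c < y ∧ ¬ ∀ d, (c < d ∧ ¬ r c d) → y < d) → c < x) := by
    intro x y hxy
    rw [intervalSetoid_apply hxy]
    constructor
    · rintro H c ⟨hc, hc'⟩
      by_contra! hxc
      refine hc' fun d hd => ?_
      by_contra! hdy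
      exact hd.2 (H c ⟨hxc, hc.le⟩ d ⟨hxc.trans hd.1.le, hdy⟩ hd.1)
    · intro H a ha b hb hab
      by_contra hrab
      exact absurd (H a ⟨hab.trans_le hb.2, fun H' => absurd (H' b ⟨hab, hrab⟩) hb.2.not_gt⟩)
        ha.1.not_gt
  convert h3 using 3 with x y
  rcases lt_trichotomy x y with hxy | rfl | hxy
  · simp only [key x y hxy.le, hxy.le, hxy.not_ge, true_and, false_and, or_false]
  · simp only [key x x le_rfl, le_rfl, true_and, or_self]
  · rw [show intervalSetoid r hr x y ↔ intervalSetoid r hr y x from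
      ⟨(intervalSetoid r hr).symm, (intervalSetoid r hr).symm⟩]
    simp only [key y x hxy.le, hxy.le, hxy.not_ge, true_and, false_and, false_or]

end IntervalSetoid

namespace IsHomogeneousFamily

variable {X Y : Type*} [LinearOrder X] [LinearOrder Y] {𝓡 : Set (X → X → Prop)} {f : X → Y}

/-! Local monotonicity. -/

/-- A counting argument: without an interval of increase, the sets `N w` below are finite and
equinumerous, yet one of them properly contains another. -/
theorem exists_strictMono_of_right_germ (h : IsHomogeneousFamily 𝓡) [NoMaxOrder X] [NoMinOrder X]
    [DenselyOrdered X] (hf : (fun a b => f a < f b) ∈ 𝓡) {x₀ y₀ : X} (hxy : x₀ < y₀)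
    (hgerm : ∀ z, x₀ < z → z < y₀ → f x₀ < f z) :
    ∃ a b : X, a < b ∧ StrictMonoOn f (Set.Icc a b) := by
  by_contra! hcon
  set N : X → X → Prop := fun w x => x < w ∧ ∀ z, (x < z ∧ ¬ f x < f z) → w < z with hN
  have hlower := h.lower_mem (h.and_mem h.lt_mem (h.not_mem hf))
  have hNmem : N ∈ 𝓡 := h.and_mem (h.swap_mem h.lt_mem) (h.swap_mem hlower)
  have hNlt : ∀ {w x z}, N w x → x < z → z ≤ w → f x < f z := by
    intro w x z hx hxz hzw
    by_contra hc
    exact (hx.2 z ⟨hxz, hc⟩).not_ge hzw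
  have hfin : ∀ w, {x | N w x}.Finite := by
    intro w
    -- Two points of one component would span an interval inside `N w`, on which `f` increases; so
    -- all components are singletons.
    obtain ⟨T, hT, hTS, hrep⟩ := exists_finite_representatives (h.finite_components hNmem w)
    have huIcc : ∀ t y : X, Set.uIcc t y ⊆ {x | N w x} → t = y := by
      intro t y hty
      by_contra hne
      refine hcon (t ⊓ y) (t ⊔ y) (inf_lt_sup.2 hne) fun a ha b hb hab => ?_
      exact hNlt (hty ha) hab (hty hb).1.le
    refine hT.subset fun y hy => ?_
    obtain ⟨t, ht, hty⟩ := hrep y hy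
    exact huIcc t y hty ▸ ht
  have hcard : ∀ w w', {x | N w x}.ncard = {x | N w' x}.ncard := by
    intro w w'
    obtain ⟨g, rfl, hg⟩ := h.exists_equiv w w'
    rw [← Set.ncard_image_of_injective _ g.injective]
    congr 1
    ext x
    obtain ⟨x, rfl⟩ := g.surjective x
    simp only [g.injective.mem_set_image, Set.mem_ofPred_eq]
    exact hg N hNmem w x
  -- The new point `x` is chosen below `x₀` but above all of the finite set `N x₀`; the auxiliary
  -- `c` serves when that set is empty.
  obtain ⟨x, hxw, hxN⟩ : ∃ x, x < x₀ ∧ ∀ y, N x₀ y → y < x := by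
    obtain ⟨c, hc⟩ := exists_lt x₀
    obtain ⟨m, hm, hmax⟩ := ((hfin x₀).insert c).exists_maximalFor id _ ⟨c, Set.mem_insert _ _⟩
    have hmlt : m < x₀ := by
      rcases hm with rfl | hm
      exacts [hc, hm.1]
    obtain ⟨x, hmx, hx⟩ := exists_between hmlt
    refine ⟨x, hx, fun y hy => lt_of_le_of_lt ?_ hmx⟩
    exact (le_total y m).elim id fun h => hmax (Set.mem_insert_of_mem _ hy) h
  obtain ⟨y₁, hxy₁, hy₁⟩ := exists_between hxy
  -- The right germ at `x₀` is transported to `x`. The bound must be strict, hence the point `y₁`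
  -- inside the germ rather than `y₀`.
  obtain ⟨w', hw'⟩ := h.of_exists (h.and_mem h.lt_mem hlower)
    ⟨y₁, hxy₁, fun z hz => lt_of_lt_of_le hy₁ (not_lt.1 fun hlt => hz.2 (hgerm z hz.1 hlt))⟩ x
  obtain ⟨w, hxw₁, hw⟩ := exists_between (lt_min hw'.1 hxw)
  -- Lowering `x₀` to `w` weakens the condition on old points, which all lie below `x < w`, and `w`
  -- is close enough to `x` for `x` itself to qualify.
  have hsub : insert x {y | N x₀ y} ⊆ {y | N w y} := by
    rintro y (rfl | hy)
    · exact ⟨hxw₁, fun z hz => (hw.trans_le (min_le_left _ _)).trans (hw'.2 z hz)⟩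
    · exact ⟨(hxN y hy).trans hxw₁,
        fun z hz => (hw.trans_le (min_le_right _ _)).trans (hy.2 z hz)⟩
  have hle := Set.ncard_le_ncard hsub (hfin w)
  have hx : x ∉ {y | N x₀ y} := fun hx => lt_irrefl _ (hxN x hx)
  rw [Set.ncard_insert_of_notMem hx (hfin x₀), hcard x₀ w] at hle
  omega

theorem exists_const_or_strictMono_or_strictAnti (h : IsHomogeneousFamily 𝓡) [Nontrivial X]
    (hf : (fun a b => f a < f b) ∈ 𝓡) :
    ∃ a b : X, a < b ∧ ((∀ x ∈ Set.Icc a b, ∀ y ∈ Set.Icc a b, x < y → f x = f y) ∨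
      StrictMonoOn f (Set.Icc a b) ∨ StrictAntiOn f (Set.Icc a b)) := by
  by_contra! hcon
  have : NoMaxOrder X := h.noMaxOrder
  have : NoMinOrder X := h.noMinOrder
  -- Two adjacent points already form an interval on which `f` is constant or strictly monotone.
  have : DenselyOrdered X := by
    refine ⟨fun a b hab => ?_⟩
    by_contra! hno
    have hIcc : ∀ x ∈ Set.Icc a b, ∀ y ∈ Set.Icc a b, x < y → x = a ∧ y = b := by
      intro x hx y hy hxy
      refine ⟨?_, ?_⟩
      · by_contra hne
        exact ((hno x (lt_of_le_of_ne hx.1 (Ne.symm hne))).trans_lt hxy).not_ge hy.2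
      · by_contra hne
        have hay : a < y := hx.1.trans_lt hxy
        exact hne (le_antisymm hy.2 (hno y hay))
    obtain ⟨⟨x, hx, y, hy, hxy, h1⟩, h2, h3⟩ := hcon a b hab
    obtain ⟨rfl, rfl⟩ := hIcc x hx y hy hxy
    rcases lt_or_gt_of_ne h1 with h1 | h1
    · refine h2 fun u hu v hv huv => ?_
      obtain ⟨rfl, rfl⟩ := hIcc u hu v hv huv
      exact h1
    · refine h3 fun u hu v hv huv => ?_
      obtain ⟨rfl, rfl⟩ := hIcc u hu v hv huv
      exact h1
  obtain ⟨x⟩ : Nonempty X := inferInstance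
  rcases right_germ (S := {y | f x < f y}) (x := x)
    (h.finite_components (h.and_mem hf h.lt_mem) x) with ⟨y, hxy, hy⟩ | ⟨y, hxy, hy⟩
  · obtain ⟨a, b, hab, hmono⟩ := h.exists_strictMono_of_right_germ hf hxy
      fun z h1 h2 => hy ⟨h1, h2⟩
    exact (hcon a b hab).2.1 hmono
  rcases right_germ (S := {y | f y < f x}) (x := x)
    (h.finite_components (h.and_mem (h.swap_mem hf) h.lt_mem) x) with ⟨y', hxy', hy'⟩ | ⟨y', hxy', hy'⟩
  · obtain ⟨a, b, hab, hmono⟩ := h.exists_strictMono_of_right_germ (f := OrderDual.toDual ∘ f)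
      (h.swap_mem hf) hxy' fun z h1 h2 => hy' ⟨h1, h2⟩
    exact (hcon a b hab).2.2 fun u hu v hv huv => hmono hu hv huv
  -- Neither strict inequality holds just after `x`, so `f` equals `f x` on a closed interval there.
  · obtain ⟨b, hxb, hb⟩ := exists_between (lt_min hxy hxy')
    obtain ⟨⟨u, hu, v, hv, huv, hne⟩, -⟩ := hcon x b hxb
    have heq : ∀ u ∈ Set.Icc x b, f u = f x := by
      intro u hu
      rcases hu.1.eq_or_lt with rfl | hxu
      · rfl
      have hub := hu.2.trans_lt hb
      exact le_antisymm (not_lt.1 (hy ⟨hxu, hub.trans_le (min_le_left _ _)⟩))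
        (not_lt.1 (hy' ⟨hxu, hub.trans_le (min_le_right _ _)⟩))
    exact hne ((heq u hu).trans (heq v hv).symm)

/-- One interval with a given behaviour makes the corresponding `intervalSetoid` nontrivial. Its
definition uses no parameters, so the endpoints of that interval do not enter. -/
theorem local_monotonicity (h : IsHomogeneousFamily 𝓡) [Nontrivial X]
    (hf : (fun a b => f a < f b) ∈ 𝓡) :
    ∃ E : Setoid X, (fun a b => E a b) ∈ 𝓡 ∧ IsConvexEquiv E ∧ E ≠ ⊥ ∧
      ∀ a, (∀ b c, E a b → E a c → f b = f c) ∨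
        StrictMonoOn f {b | E a b} ∨ StrictAntiOn f {b | E a b} := by
  have hne : ∀ {E : Setoid X} {a b : X}, a < b → E a b → E ≠ ⊥ := by
    rintro _ a b hab hE rfl
    exact hab.ne hE
  obtain ⟨a, b, hab, hconst | hmono | hanti⟩ := h.exists_const_or_strictMono_or_strictAnti hf
  · have hr : ∀ a b c : X, f a = f b → f b = f c → f a = f c := fun _ _ _ => Eq.trans
    have hmem : (fun a b : X => f a = f b) ∈ 𝓡 := by
      have := h.and_mem (h.not_mem hf) (h.not_mem (h.swap_mem hf))
      convert this using 3
      rw [not_lt, not_lt, and_comm]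
      exact le_antisymm_iff
    refine ⟨intervalSetoid _ hr, h.intervalSetoid_mem hmem, isConvexEquiv_intervalSetoid,
      hne hab ((intervalSetoid_apply hab.le).2 hconst), fun x => Or.inl fun y z hy hz => ?_⟩
    rcases lt_trichotomy y z with hyz | rfl | hyz
    exacts [intervalSetoid_lt (r := fun a b => f a = f b) (hr := hr) hy hz hyz, rfl,
      (intervalSetoid_lt (r := fun a b => f a = f b) (hr := hr) hz hy hyz).symm]
  · have hr : ∀ a b c : X, f a < f b → f b < f c → f a < f c := fun _ _ _ => lt_trans
    exact ⟨intervalSetoid _ hr, h.intervalSetoid_mem hf, isConvexEquiv_intervalSetoid,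
      hne hab ((intervalSetoid_apply hab.le).2 fun x hx y hy hxy => hmono hx hy hxy),
      fun x => Or.inr (Or.inl fun y hy z hz hyz =>
        intervalSetoid_lt (r := fun a b => f a < f b) (hr := hr) hy hz hyz)⟩
  · have hr : ∀ a b c : X, f b < f a → f c < f b → f c < f a := fun _ _ _ h h' => h'.trans h
    exact ⟨intervalSetoid _ hr, h.intervalSetoid_mem (h.swap_mem hf), isConvexEquiv_intervalSetoid,
      hne hab ((intervalSetoid_apply hab.le).2 fun x hx y hy hxy => hanti hx hy hxy),
      fun x => Or.inr (Or.inr fun y hy z hz hyz =>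
        intervalSetoid_lt (r := fun a b => f b < f a) (hr := hr) hy hz hyz)⟩

end IsHomogeneousFamily

namespace IsHomogeneousFamily

variable {X Y : Type*} [LinearOrder X] [LinearOrder Y] {𝓡 : Set (X → X → Prop)} {f : X → Y}

/-! Upper monotonicity. -/

/-- `s` lies strictly below the final segment starting at `w` with respect to `f`. -/
def BelowTail (f : X → Y) (w s : X) : Prop := ∀ y, w ≤ y → f s < f y

theorem BelowTail.mono {w w' s : X} (h : w ≤ w') (hs : BelowTail f w s) : BelowTail f w' s :=
  fun y hy => hs y (h.trans hy)

theorem BelowTail.lt {w s : X} (hs : BelowTail f w s) : s < w :=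
  not_le.1 fun h => lt_irrefl _ (hs s h)

/-- Equality of the sets of points below the tails. -/
def tailSetoid (f : X → Y) : Setoid X where
  r w w' := ∀ s, BelowTail f w s ↔ BelowTail f w' s
  iseqv := ⟨fun _ _ => Iff.rfl, fun h s => (h s).symm, fun h h' s => (h s).trans (h' s)⟩

theorem isConvexEquiv_tailSetoid : IsConvexEquiv (tailSetoid f) :=
  .of_le fun _ _ _ hab hbc h s =>
    ⟨fun hs => hs.mono hab, fun hs => (h s).2 (hs.mono hbc)⟩

/-- If all points below the tail at `w` were smaller than `x`, they would also be below the tail at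
`x`: a `y ≥ x` with `f y ≤ f s` would itself be below the tail at `w`. -/
theorem exists_belowTail_ge {x w : X} (hxw : x < w) (hE : ¬ tailSetoid f x w) :
    ∃ s, BelowTail f w s ∧ x ≤ s := by
  by_contra! hcon
  refine hE fun s => ⟨fun hs => hs.mono hxw.le, fun hs y hy => ?_⟩
  by_contra! hys
  refine (hcon y fun v hv => ?_).not_ge hy
  exact hys.trans_lt (hs v hv)

theorem BelowTail.lt_of_rel {x w s : X} (hs : BelowTail f w s) (hE : tailSetoid f x w) : s < x :=
  ((hE s).2 hs).lt

theorem belowTail_mem (h : IsHomogeneousFamily 𝓡) (hf : (fun a b => f a < f b) ∈ 𝓡) :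
    BelowTail f ∈ 𝓡 := by
  have := h.swap_mem (h.upper_mem (h.not_mem hf))
  convert this using 3 with w s
  exact forall_congr' fun y => by rw [← not_le (a := w), not_imp_not]

/-- For `x ≤ y`, equivalence amounts to `x` being a strict upper bound of the points below the tail
at `y`, which is an admissible operation. -/
theorem tailSetoid_mem (h : IsHomogeneousFamily 𝓡) (hf : (fun a b => f a < f b) ∈ 𝓡) :
    (fun a b => tailSetoid f a b) ∈ 𝓡 := by
  have h2 := h.upper_mem (h.belowTail_mem hf)
  have h3 := h.or_mem (h.and_mem h.le_mem (h.swap_mem h2)) (h.and_mem (h.swap_mem h.le_mem) h2)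
  have key : ∀ x y : X, x ≤ y → (tailSetoid f x y ↔ ∀ s, BelowTail f y s → s < x) := by
    refine fun x y hxy => ⟨fun hE s hs => hs.lt_of_rel hE, fun hall => ?_⟩
    by_contra hE
    have hlt : x < y := lt_of_le_of_ne hxy fun he => hE (he ▸ (tailSetoid f).refl x)
    obtain ⟨s, hs, hxs⟩ := exists_belowTail_ge hlt hE
    exact (hall s hs).not_ge hxs
  convert h3 using 3 with x y
  rcases lt_trichotomy x y with hxy | rfl | hxy
  · simp only [key x y hxy.le, hxy.le, hxy.not_ge, true_and, false_and, or_false]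
  · simp only [key x x le_rfl, le_rfl, true_and, or_self]
  · rw [show tailSetoid f x y ↔ tailSetoid f y x from
      ⟨(tailSetoid f).symm, (tailSetoid f).symm⟩]
    simp only [key y x hxy.le, hxy.le, hxy.not_ge, true_and, false_and, false_or]

/-- The pairs at which `f` fails to increase along the classes of `tailSetoid f`. -/
def Defect (f : X → Y) (w x : X) : Prop := x < w ∧ ¬ tailSetoid f x w ∧ ¬ BelowTail f w x

theorem defect_mem (h : IsHomogeneousFamily 𝓡) (hf : (fun a b => f a < f b) ∈ 𝓡) :
    Defect f ∈ 𝓡 :=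
  h.and_mem (h.swap_mem h.lt_mem) (h.and_mem (h.swap_mem (h.not_mem (h.tailSetoid_mem hf)))
    (h.not_mem (h.belowTail_mem hf)))

/-- Each convex component of the defects of `w` lies in one class: between inequivalent `a < b`
there is, in `[a, b)`, a point below the tail at `b`, hence below the tail at `w`, and such a point
is not a defect. -/
theorem exists_defect_cover (h : IsHomogeneousFamily 𝓡) (hf : (fun a b => f a < f b) ∈ 𝓡) (w : X) :
    ∃ T : Finset X, (∀ t ∈ T, Defect f w t) ∧ ∀ y, Defect f w y → ∃ t ∈ T, tailSetoid f t y := by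
  obtain ⟨T, hT, hTS, hrep⟩ := exists_finite_representatives
    (h.finite_components (h.defect_mem hf) w)
  refine ⟨hT.toFinset, fun t ht => hTS (hT.mem_toFinset.1 ht), fun y hy => ?_⟩
  obtain ⟨t, ht, hty⟩ := hrep y hy
  refine ⟨t, hT.mem_toFinset.2 ht, ?_⟩
  have key : ∀ a b, a < b → Set.Icc a b ⊆ {y | Defect f w y} → tailSetoid f a b := by
    intro a b hab hsub
    by_contra hE
    obtain ⟨s, hs, has⟩ := exists_belowTail_ge hab hE
    exact (hsub ⟨has, hs.lt.le⟩).2.2 (hs.mono (hsub (Set.right_mem_Icc.2 hab.le)).1.le)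
  rcases lt_trichotomy t y with hlt | rfl | hlt
  · exact key t y hlt (Set.uIcc_of_le hlt.le ▸ hty)
  · exact (tailSetoid f).refl _
  · exact (tailSetoid f).symm (key y t hlt (Set.uIcc_of_ge hlt.le ▸ hty))

/-- From one defect, homogeneity gives defects everywhere. The least number of classes covering the
defects of `w` does not depend on `w`, and a point `w₂` with strictly more defect classes than `w`
contradicts this. -/
theorem not_defect (h : IsHomogeneousFamily 𝓡) (hf : (fun a b => f a < f b) ∈ 𝓡) (w x : X) :
    ¬ Defect f w x := by
  classical
  intro hwx
  set E := tailSetoid f with hEdef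
  have hconv : IsConvexEquiv E := isConvexEquiv_tailSetoid
  have hEmem := h.tailSetoid_mem hf
  have hHmem := h.defect_mem hf
  obtain ⟨T, hTH, hTcov⟩ := h.exists_defect_cover hf w
  obtain ⟨t₀, ht₀, -⟩ := hTcov x hwx
  obtain ⟨x₀, hx₀, hmax⟩ := T.exists_maximalFor id ⟨t₀, ht₀⟩
  have hlast : ∀ y, Defect f w y → y ≤ x₀ ∨ E x₀ y := by
    intro y hy
    obtain ⟨t, ht, hty⟩ := hTcov y hy
    refine or_iff_not_imp_left.2 fun hyx => ?_
    have htx : t ≤ x₀ := (le_total t x₀).elim id fun h => hmax ht h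
    exact hconv.right htx (not_le.1 hyx).le hty
  have hx₀w := hTH x₀ hx₀
  -- A class lies strictly between those of `x₀` and `w`. Otherwise a point `s ≥ x₀` below the tail
  -- at `w` is equivalent to `x₀`; moving `x₀` to `s` moves `w` to a point equivalent to `w`, whose
  -- tail `s` is then below although `s` should be a defect there.
  obtain ⟨w₁, hxw₁, hw₁, hEx, hEw⟩ : ∃ z, x₀ < z ∧ z < w ∧ ¬ E x₀ z ∧ ¬ E z w := by
    by_contra! hcon
    obtain ⟨s, hs, hxs⟩ := exists_belowTail_ge hx₀w.1 hx₀w.2.1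
    have hsw : ¬ E s w := fun hE => lt_irrefl _ (hs.lt_of_rel hE)
    have hxs' : E x₀ s := by
      rcases hxs.eq_or_lt with rfl | hlt
      · exact E.refl _
      · by_contra hE
        exact hsw (hcon s hlt hs.lt hE)
    obtain ⟨g, hgs, hg⟩ := h.exists_equiv x₀ s
    have hdef : Defect f (g w) s := hgs ▸ (hg _ hHmem w x₀).1 hx₀w
    have hgw : g w < w := not_le.1 fun hle => hdef.2.2 (hs.mono hle)
    have hxgw : ¬ E x₀ (g w) := fun hE => hdef.2.1 (E.trans (E.symm hxs') hE)
    have hEgw := hcon (g w) (hxs.trans_lt hdef.1) hgw hxgw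
    exact hdef.2.2 ((hEgw s).2 hs)
  obtain ⟨w₂, hw₂⟩ := h.of_exists (h.swap_mem hHmem) ⟨w, hx₀w⟩ w₁
  -- If `w ≤ w₂`, then `w₁` would be a defect of `w` beyond the last class of defects.
  have hw₂w : w₂ < w := by
    by_contra! hle
    rcases hlast w₁ ⟨hw₁, hEw, fun hB => hw₂.2.2 (hB.mono hle)⟩ with hle' | hE
    exacts [hle'.not_gt hxw₁, hEx hE]
  have hlt : ∀ y, Defect f w y → y < w₁ ∧ ¬ E y w₁ := by
    intro y hy
    rcases hlast y hy with hle | hE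
    · exact ⟨hle.trans_lt hxw₁, fun hE => hEx (hconv.right hle hxw₁.le hE)⟩
    · exact ⟨not_le.1 fun hle => hEx (hconv.left hxw₁.le hle hE),
        fun hE' => hEx (E.trans hE hE')⟩
  have hsub : ∀ y, Defect f w y → Defect f w₂ y := fun y hy =>
    ⟨(hlt y hy).1.trans hw₂.1, fun hE => hw₂.2.1 (hconv.right (hlt y hy).1.le hw₂.1.le hE),
      fun hB => hy.2.2 (hB.mono hw₂w.le)⟩
  let Cov : ℕ → X → Prop := fun k w =>
    ∃ T : Finset X, T.card ≤ k ∧ ∀ y, Defect f w y → ∃ t ∈ T, E t y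
  have hCov : ∀ k a b, Cov k a → Cov k b := by
    rintro k a b ⟨T, hTk, hT⟩
    obtain ⟨g, rfl, hg⟩ := h.exists_equiv a b
    refine ⟨T.map g.toEmbedding, by rwa [Finset.card_map], fun y hy => ?_⟩
    obtain ⟨y, rfl⟩ := g.surjective y
    obtain ⟨t, ht, hty⟩ := hT y ((hg _ hHmem a y).2 hy)
    exact ⟨g t, Finset.mem_map_of_mem g.toEmbedding ht, (hg _ hEmem t y).1 hty⟩
  have hex : ∃ k, Cov k w := ⟨_, T, le_rfl, hTcov⟩
  obtain ⟨T', hT'k, hT'⟩ := hCov _ w w₂ (Nat.find_spec hex)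
  -- The representative `t` of the class of `w₁` covers no defect of `w`, so removing it from a
  -- minimal-size cover for `w₂` leaves a smaller cover for `w`.
  obtain ⟨t, ht, htw⟩ := hT' w₁ hw₂
  have hmin := Nat.find_min' hex (m := T'.card - 1) ⟨T'.erase t, by rw [Finset.card_erase_of_mem ht],
    fun y hy => by
      obtain ⟨t', ht', hty⟩ := hT' y (hsub y hy)
      refine ⟨t', Finset.mem_erase.2 ⟨?_, ht'⟩, hty⟩
      rintro rfl
      exact (hlt y hy).2 (E.trans (E.symm hty) htw)⟩
  have := Finset.card_pos.2 ⟨t, ht⟩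
  omega

theorem exists_lt_of_not_rel (h : IsHomogeneousFamily 𝓡) (hf : (fun a b => f a < f b) ∈ 𝓡)
    {x y : X} (hxy : ∀ z, y ≤ z → f x < f z) :
    ∃ E : Setoid X, (fun a b => E a b) ∈ 𝓡 ∧ IsConvexEquiv E ∧ E ≠ ⊤ ∧
      ∀ a b, a < b → ¬ E a b → f a < f b := by
  refine ⟨tailSetoid f, h.tailSetoid_mem hf, isConvexEquiv_tailSetoid, fun htop => ?_,
    fun a b hab hE => ?_⟩
  · have hE : tailSetoid f x y := by rw [htop]; trivial
    exact lt_irrefl x (BelowTail.lt_of_rel hxy hE)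
  · by_contra hlt
    exact h.not_defect hf b a ⟨hab, hE, fun hB => hlt (hB b le_rfl)⟩

theorem upper_monotonicity (h : IsHomogeneousFamily 𝓡) (hf : (fun a b => f a < f b) ∈ 𝓡)
    (hconst : ∃ a b, f a ≠ f b) :
    ∃ E : Setoid X, (fun a b => E a b) ∈ 𝓡 ∧ IsConvexEquiv E ∧ E ≠ ⊤ ∧
      ((∀ a b, a < b → ¬ E a b → f a < f b) ∨ (∀ a b, a < b → ¬ E a b → f b < f a)) := by
  obtain ⟨x, x', hxx'⟩ := hconst
  have : Nonempty X := ⟨x⟩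
  have hfin := fun a => h.finite_components hf a
  rcases eventually_mem_or_notMem (hfin x) with ⟨y, hy⟩ | ⟨y, hy⟩
  · obtain ⟨E, h1, h2, h3, h4⟩ := h.exists_lt_of_not_rel hf (x := x) (y := y) fun z hz => hy hz
    exact ⟨E, h1, h2, h3, Or.inl h4⟩
  rcases eventually_mem_or_notMem (h.finite_components (h.swap_mem hf) x) with
    ⟨y', hy'⟩ | ⟨y', hy'⟩
  · obtain ⟨E, h1, h2, h3, h4⟩ := h.exists_lt_of_not_rel (f := OrderDual.toDual ∘ f)
      (h.swap_mem hf) (x := x) (y := y') fun z hz => hy' hz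
    exact ⟨E, h1, h2, h3, Or.inr h4⟩
  -- Here `f` is eventually equal to `f x`. An automorphism taking `x` to `x'` shows that it is also
  -- eventually equal to `f x'`, whence `f x = f x'`.
  · exfalso
    have hmem := h.swap_mem (h.lower_mem (h.or_mem hf (h.swap_mem hf)))
    have hev : ∃ w, ∀ z, w ≤ z → f z = f x := ⟨y ⊔ y', fun z hz =>
      le_antisymm (not_lt.1 (hy (le_sup_left.trans hz))) (not_lt.1 (hy' (le_sup_right.trans hz)))⟩
    obtain ⟨w, hw⟩ := hev
    obtain ⟨g, rfl, hg⟩ := h.exists_equiv x x'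
    have hgw : ∀ z, g w ≤ z → f z = f (g x) := by
      intro z hz
      obtain ⟨z, rfl⟩ := g.surjective z
      have hwz := hw z ((hg _ h.le_mem w z).2 hz)
      refine le_antisymm (not_lt.1 fun hlt => ?_) (not_lt.1 fun hlt => ?_)
      · exact ((hg _ hf x z).2 hlt).ne' hwz
      · exact ((hg _ hf z x).2 hlt).ne hwz
    exact hxx' ((hw (w ⊔ g w) le_sup_left).symm.trans (hgw _ le_sup_right))

end IsHomogeneousFamily

/-! The map induced on the quotients. -/

theorem ClassLT.lt_and_not_rel {X : Type*} [LinearOrder X] {E : Setoid X} {a b : X}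
    (h : ClassLT E (Quotient.mk E a) (Quotient.mk E b)) : a < b ∧ ¬ E a b :=
  ⟨h a b rfl rfl, fun hE => lt_irrefl b (h b b (Quotient.sound (E.symm hE)) rfl)⟩

/-- Points of different classes have different values, so the kernel of `f` is contained in `E` and
the image relation is `E` read through `f`. For convexity, a `b` outside the class of `a` and `c`
lies on one side of both, so `f b` cannot lie between `f a` and `f c`. -/
theorem exists_image_setoid {X Y : Type*} [LinearOrder X] [LinearOrder Y] {f : X → Y}
    {E : Setoid X} (hconv : IsConvexEquiv E) (hE : (∀ a b, a < b → ¬ E a b → f a < f b) ∨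
      ∀ a b, a < b → ¬ E a b → f b < f a) :
    ∃ F : Setoid (Set.range f), (∀ y z, F y z ↔ imageRel f E y z) ∧ IsConvexEquiv F ∧
      ∀ a b, F ⟨f a, Set.mem_range_self a⟩ ⟨f b, Set.mem_range_self b⟩ ↔ E a b := by
  have hker : ∀ a b, f a = f b → E a b := by
    intro a b hab
    by_contra hn
    have hn' : ¬ E b a := fun h => hn (E.symm h)
    rcases lt_trichotomy a b with h | rfl | h
    · rcases hE with hE | hE
      exacts [(hE a b h hn).ne hab, (hE a b h hn).ne' hab]
    · exact hn (E.refl _)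
    · rcases hE with hE | hE
      exacts [(hE b a h hn').ne' hab, (hE b a h hn').ne hab]
  have himage : ∀ a b, imageRel f E ⟨f a, Set.mem_range_self a⟩ ⟨f b, Set.mem_range_self b⟩ ↔
      E a b := by
    refine fun a b => ⟨?_, fun h => ⟨a, b, h, rfl, rfl⟩⟩
    rintro ⟨c, d, hcd, hc, hd⟩
    exact E.trans (E.symm (hker c a hc)) (E.trans hcd (hker d b hd))
  let F : Setoid (Set.range f) :=
    { r := imageRel f E
      iseqv := by
        refine ⟨?_, ?_, ?_⟩
        · rintro ⟨_, a, rfl⟩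
          exact (himage a a).2 (E.refl a)
        · rintro ⟨_, a, rfl⟩ ⟨_, b, rfl⟩ h
          exact (himage b a).2 (E.symm ((himage a b).1 h))
        · rintro ⟨_, a, rfl⟩ ⟨_, b, rfl⟩ ⟨_, c, rfl⟩ h h'
          exact (himage a c).2 (E.trans ((himage a b).1 h) ((himage b c).1 h')) }
  refine ⟨F, fun _ _ => Iff.rfl, .of_le ?_, himage⟩
  rintro ⟨_, a, rfl⟩ ⟨_, b, rfl⟩ ⟨_, c, rfl⟩ hab hbc h
  replace h : E a c := (himage a c).1 h
  refine (himage a b).2 ?_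
  by_contra hn
  have hn' : ¬ E b a := fun h => hn (E.symm h)
  have hcb : ¬ E c b := fun h' => hn (E.trans h h')
  have hbc' : ¬ E b c := fun h => hcb (E.symm h)
  have hab' : a ≠ b := fun he => hn (he ▸ E.refl a)
  have hcb' : c ≠ b := fun he => hcb (he ▸ E.refl c)
  replace hab : f a ≤ f b := hab
  replace hbc : f b ≤ f c := hbc
  rcases hE with hE | hE
  · rcases lt_or_gt_of_ne hab' with h1 | h1
    · rcases lt_or_gt_of_ne hcb' with h2 | h2
      exacts [(hE c b h2 hcb).not_ge hbc, hn (hconv.left h1.le h2.le h)]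
    · exact (hE b a h1 hn').not_ge hab
  · rcases lt_or_gt_of_ne hab' with h1 | h1
    · exact (hE a b h1 hn).not_ge hab
    · rcases lt_or_gt_of_ne hcb' with h2 | h2
      exacts [hn' (hconv.right h2.le h1.le (E.symm h)), (hE b c h2 hbc').not_ge hbc]

theorem exists_quotient_map {X Y : Type*} [LinearOrder X] [LinearOrder Y] {f : X → Y}
    {E : Setoid X} (hconv : IsConvexEquiv E) (hE : (∀ a b, a < b → ¬ E a b → f a < f b) ∨
      ∀ a b, a < b → ¬ E a b → f b < f a) :
    ∃ F : Setoid (Set.range f), (∀ y z, F y z ↔ imageRel f E y z) ∧ IsConvexEquiv F ∧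
      ∃ fE : Quotient E → Quotient F,
        (∀ a, fE (Quotient.mk E a) = Quotient.mk F ⟨f a, Set.mem_range_self a⟩) ∧
        (((∀ a b, ClassLT E (Quotient.mk E a) (Quotient.mk E b) → f a < f b) ∧
            (∀ C C', ClassLT E C C' → ClassLT F (fE C) (fE C'))) ∨
          ((∀ a b, ClassLT E (Quotient.mk E a) (Quotient.mk E b) → f b < f a) ∧
            (∀ C C', ClassLT E C C' → ClassLT F (fE C') (fE C)))) := by
  obtain ⟨F, hF, hFconv, hFE⟩ := exists_image_setoid hconv hE
  refine ⟨F, hF, hFconv, Quotient.map _ fun a b h => (hFE a b).2 h, fun a => rfl, ?_⟩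
  refine hE.imp (fun hE => ?_) fun hE => ?_
  all_goals
    have hlt := fun a b (h : ClassLT E (Quotient.mk E a) (Quotient.mk E b)) =>
      hE a b h.lt_and_not_rel.1 h.lt_and_not_rel.2
    refine ⟨hlt, fun C C' => ?_⟩
    induction C using Quotient.ind
    induction C' using Quotient.ind
    rintro h ⟨_, a, rfl⟩ ⟨_, b, rfl⟩ ha hb
    replace ha := Quotient.sound ((hFE _ _).1 (Quotient.exact ha))
    replace hb := Quotient.sound ((hFE _ _).1 (Quotient.exact hb))
    rw [← ha, ← hb] at h
    exact hlt _ _ h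

namespace MSLanguage

variable {L : MSLanguage.{u, v, w}}

/-! Substitution. -/

/-- Simultaneous substitution of terms for the variables of a term. -/
def Term.subst {ι κ : Type} {σ : ι → L.Sorts} {τ : κ → L.Sorts} (f : ∀ i, L.Term τ (σ i)) :
    {s : L.Sorts} → L.Term σ s → L.Term τ s
  | _, .var i => f i
  | _, .func F ts => .func F (fun i => (ts i).subst f)

/-- The extension of a substitution to a context with a new variable, which is left alone. -/
def extendSubst {ι κ : Type} {σ : ι → L.Sorts} {τ : κ → L.Sorts} (s : L.Sorts)
    (f : ∀ i, L.Term τ (σ i)) : ∀ i, L.Term (extend s τ) (extend s σ i)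
  | none => .var (σ := extend s τ) none
  | some i => (f i).subst fun j => .var (σ := extend s τ) (some j)

/-- Simultaneous substitution of terms for the free variables of a formula. -/
def Formula.subst : {ι : Type} → {σ : ι → L.Sorts} → L.Formula σ → {κ : Type} →
    {τ : κ → L.Sorts} → (∀ i, L.Term τ (σ i)) → L.Formula τ
  | _, _, .falsum, _, _, _ => .falsum
  | _, _, .equal t₁ t₂, _, _, f => .equal (t₁.subst f) (t₂.subst f)
  | _, _, .rel R ts, _, _, f => .rel R (fun i => (ts i).subst f)
  | _, _, .imp φ ψ, _, _, f => .imp (φ.subst f) (ψ.subst f)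
  | _, _, .all (s := s) φ, _, _, f => .all (φ.subst (extendSubst s f))

/-- The conjunction of two formulas. -/
def Formula.and {ι : Type} {σ : ι → L.Sorts} (φ ψ : L.Formula σ) : L.Formula σ :=
  (φ.imp ψ.not).not

/-- Existential quantification. -/
def Formula.ex {ι : Type} {σ : ι → L.Sorts} {s : L.Sorts} (φ : L.Formula (extend s σ)) :
    L.Formula σ :=
  φ.not.all.not

section Semantics

variable {M : L.Sorts → Type x} [L.Structure M] {ι κ : Type} {σ : ι → L.Sorts} {τ : κ → L.Sorts}

theorem Term.eval_subst (f : ∀ i, L.Term τ (σ i)) (v : Tuple M τ) {s : L.Sorts}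
    (t : L.Term σ s) : (t.subst f).eval v = t.eval (fun i => (f i).eval v) := by
  induction t with
  | var i => rfl
  | func F ts ih => simp only [Term.subst, Term.eval, ih]

theorem eval_extendSubst {s : L.Sorts} (f : ∀ i, L.Term τ (σ i)) (c : M s) (v : Tuple M τ) :
    (fun i => (extendSubst s f i).eval (extendTuple c v)) =
      extendTuple c (fun i => (f i).eval v) := by
  funext i
  cases i with
  | none => rfl
  | some i => exact Term.eval_subst _ _ _

theorem Formula.holds_subst (φ : L.Formula σ) (f : ∀ i, L.Term τ (σ i)) (v : Tuple M τ) :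
    (φ.subst f).Holds v ↔ φ.Holds (fun i => (f i).eval v) := by
  induction φ generalizing κ with
  | falsum => rfl
  | equal t₁ t₂ => simp only [Formula.subst, Formula.Holds, Term.eval_subst]
  | rel R ts => simp only [Formula.subst, Formula.Holds, Term.eval_subst]
  | imp φ ψ ih₁ ih₂ => simp only [Formula.subst, Formula.Holds, ih₁, ih₂]
  | all φ ih => simp only [Formula.subst, Formula.Holds, ih, eval_extendSubst]

theorem Formula.holds_not {φ : L.Formula σ} {v : Tuple M σ} : φ.not.Holds v ↔ ¬ φ.Holds v :=
  Iff.rfl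

theorem Formula.holds_and {φ ψ : L.Formula σ} {v : Tuple M σ} :
    (φ.and ψ).Holds v ↔ φ.Holds v ∧ ψ.Holds v := by
  simp only [Formula.and, Formula.Holds, Formula.holds_not]
  tauto

theorem Formula.holds_ex {s : L.Sorts} {φ : L.Formula (extend s σ)} {v : Tuple M σ} :
    φ.ex.Holds v ↔ ∃ c, φ.Holds (extendTuple c v) := by
  simp only [Formula.ex, Formula.Holds, Formula.holds_not]
  push Not
  rfl

/-- The variable `j` as a term of a sort equal to its sort. -/
def Term.varOf (τ : κ → L.Sorts) (j : κ) {s : L.Sorts} (h : τ j = s) : L.Term τ s := h ▸ .var j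

theorem Term.eval_varOf (j : κ) {s : L.Sorts} (h : τ j = s) (v : Tuple M τ) :
    (Term.varOf τ j h).eval v = h ▸ v j := by
  subst h
  rfl

end Semantics

/-! Definable sets. -/

section Definability

variable {M : L.Sorts → Type x} [L.Structure M] {A B : Set (Σ s, M s)}
  {ι κ : Type} {σ : ι → L.Sorts} {τ : κ → L.Sorts}

/-- Parameters may be indexed by any finite type, so that sums of contexts can be used without
renumbering by `Fin k`. -/
theorem isDefinable_of_finite [Finite κ] (c : Tuple M τ)
    (hc : ∀ j, (⟨τ j, c j⟩ : Σ s, M s) ∈ A) (φ : L.Formula (Sum.elim σ τ)) :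
    IsDefinable A {a : Tuple M σ | φ.Holds (pair a c)} := by
  obtain ⟨k, ⟨e⟩⟩ := Finite.exists_equiv_fin κ
  let f : ∀ i, L.Term (Sum.elim σ (τ ∘ e.symm)) (Sum.elim σ τ i)
    | Sum.inl i => .var (σ := Sum.elim σ (τ ∘ e.symm)) (Sum.inl i)
    | Sum.inr j => .varOf _ (Sum.inr (e j)) (congrArg τ (e.symm_apply_apply j))
  refine ⟨⟨k, τ ∘ e.symm, fun j => c (e.symm j), fun j => hc _, φ.subst f⟩, fun a => ?_⟩
  rw [FormulaOver.Holds, Formula.holds_subst]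
  suffices (fun i => (f i).eval (pair a fun j => c (e.symm j))) = pair a c by rw [this]; rfl
  funext i
  cases i with
  | inl i => rfl
  | inr j =>
    have key : ∀ (j' : κ) (h : j' = j), (congrArg τ h ▸ c j' : M (τ j)) = c j := by
      rintro j' rfl
      rfl
    exact (Term.eval_varOf _ _ _).trans (key _ (e.symm_apply_apply j))

theorem IsDefinable.mono (hAB : A ⊆ B) {D : Set (Tuple M σ)} (hD : IsDefinable A D) :
    IsDefinable B D := by
  obtain ⟨φ, hφ⟩ := hD
  exact ⟨⟨φ.k, φ.paramSort, φ.param, fun j => hAB (φ.param_mem j), φ.formula⟩, hφ⟩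

theorem IsDefinable.compl {D : Set (Tuple M σ)} (hD : IsDefinable A D) : IsDefinable A Dᶜ := by
  obtain ⟨φ, hφ⟩ := hD
  exact ⟨φ.not, fun a => not_congr (hφ a)⟩

theorem IsDefinable.inter {D D' : Set (Tuple M σ)} (hD : IsDefinable A D)
    (hD' : IsDefinable A D') : IsDefinable A (D ∩ D') := by
  obtain ⟨φ, hφ⟩ := hD
  obtain ⟨ψ, hψ⟩ := hD'
  let ρ : Fin φ.k ⊕ Fin ψ.k → L.Sorts := Sum.elim φ.paramSort ψ.paramSort
  let f : ∀ i, L.Term (Sum.elim σ ρ) (Sum.elim σ φ.paramSort i)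
    | Sum.inl i => .var (σ := Sum.elim σ ρ) (Sum.inl i)
    | Sum.inr j => .var (σ := Sum.elim σ ρ) (Sum.inr (Sum.inl j))
  let g : ∀ i, L.Term (Sum.elim σ ρ) (Sum.elim σ ψ.paramSort i)
    | Sum.inl i => .var (σ := Sum.elim σ ρ) (Sum.inl i)
    | Sum.inr j => .var (σ := Sum.elim σ ρ) (Sum.inr (Sum.inr j))
  have h := isDefinable_of_finite (A := A) (pair φ.param ψ.param)
    (by rintro (j | j); exacts [φ.param_mem j, ψ.param_mem j])
    ((φ.formula.subst f).and (ψ.formula.subst g))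
  convert h using 1
  ext a
  rw [Set.mem_inter_iff, hφ, hψ, Set.mem_ofPred_eq, Formula.holds_and, Formula.holds_subst,
    Formula.holds_subst]
  refine and_congr ?_ ?_
  · rw [FormulaOver.Holds]
    exact iff_of_eq (congrArg _ (funext fun i => by cases i <;> rfl))
  · rw [FormulaOver.Holds]
    exact iff_of_eq (congrArg _ (funext fun i => by cases i <;> rfl))

theorem isDefinable_univ : IsDefinable A (Set.univ : Set (Tuple M σ)) :=
  ⟨⟨0, Fin.elim0, fun j => j.elim0, fun j => j.elim0, Formula.falsum.not⟩,
    fun _ => ⟨fun _ => id, fun _ => trivial⟩⟩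

theorem IsDefinable.union {D D' : Set (Tuple M σ)} (hD : IsDefinable A D)
    (hD' : IsDefinable A D') : IsDefinable A (D ∪ D') := by
  have := (hD.compl.inter hD'.compl).compl
  rwa [← Set.compl_union, compl_compl] at this

/-- Preimages of definable sets under maps each coordinate of which is a coordinate of the argument
or a parameter. -/
theorem IsDefinable.preimage [Finite ι] {D : Set (Tuple M σ)} (hD : IsDefinable A D)
    (g : Tuple M τ → Tuple M σ)
    (hg : ∀ i, (∃ j, ∃ h : τ j = σ i, ∀ v, g v i = h ▸ v j) ∨
      ∃ c, (⟨σ i, c⟩ : Σ s, M s) ∈ A ∧ ∀ v, g v i = c) :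
    IsDefinable A (g ⁻¹' D) := by
  obtain ⟨φ, hφ⟩ := hD
  let I := {i // ∃ c, (⟨σ i, c⟩ : Σ s, M s) ∈ A ∧ ∀ v, g v i = c}
  choose c hcA hc using fun i : I => i.2
  let ρ : I ⊕ Fin φ.k → L.Sorts := Sum.elim (fun i : I => σ i) φ.paramSort
  have hf : ∀ i, ∃ t : L.Term (Sum.elim τ ρ) (σ i), ∀ v, t.eval (pair v (pair c φ.param)) = g v i := by
    intro i
    rcases hg i with ⟨j, h, hj⟩ | h
    · exact ⟨.varOf _ (Sum.inl j) h, fun v => (Term.eval_varOf _ _ _).trans (hj v).symm⟩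
    · exact ⟨.var (σ := Sum.elim τ ρ) (Sum.inr (Sum.inl ⟨i, h⟩)), fun v => (hc ⟨i, h⟩ v).symm⟩
  choose t ht using hf
  let f : ∀ i, L.Term (Sum.elim τ ρ) (Sum.elim σ φ.paramSort i)
    | Sum.inl i => t i
    | Sum.inr j => .var (σ := Sum.elim τ ρ) (Sum.inr (Sum.inr j))
  have h := isDefinable_of_finite (A := A) (pair c φ.param)
    (by rintro (j | j); exacts [hcA j, φ.param_mem j]) (φ.formula.subst f)
  convert h using 1
  ext a
  rw [Set.mem_preimage, hφ, Set.mem_ofPred_eq, Formula.holds_subst, FormulaOver.Holds]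
  refine iff_of_eq (congrArg _ (funext fun i => ?_))
  cases i with
  | inl i => exact (ht i a).symm
  | inr j => rfl

theorem IsDefinable.exists_extend {s : L.Sorts} {D : Set (Tuple M (extend s σ))}
    (hD : IsDefinable A D) : IsDefinable A {a | ∃ c : M s, extendTuple c a ∈ D} := by
  obtain ⟨φ, hφ⟩ := hD
  let f : ∀ i, L.Term (extend s (Sum.elim σ φ.paramSort)) (Sum.elim (extend s σ) φ.paramSort i)
    | Sum.inl none => .var (σ := extend s (Sum.elim σ φ.paramSort)) none
    | Sum.inl (some i) => .var (σ := extend s (Sum.elim σ φ.paramSort)) (some (Sum.inl i))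
    | Sum.inr j => .var (σ := extend s (Sum.elim σ φ.paramSort)) (some (Sum.inr j))
  refine ⟨⟨φ.k, φ.paramSort, φ.param, φ.param_mem, (φ.formula.subst f).ex⟩, fun a => ?_⟩
  rw [FormulaOver.Holds, Formula.holds_ex]
  refine exists_congr fun c => ?_
  rw [hφ, Formula.holds_subst, FormulaOver.Holds]
  refine iff_of_eq (congrArg _ (funext fun i => ?_))
  rcases i with (_ | i) | j <;> rfl

theorem IsDefinable.exists_pair [Finite ι] {m : ℕ} {τ : Fin m → L.Sorts}
    {D : Set (Tuple M (Sum.elim σ τ))} (hD : IsDefinable A D) :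
    IsDefinable A {a | ∃ b : Tuple M τ, pair a b ∈ D} := by
  induction m generalizing ι with
  | zero =>
    have := hD.preimage (fun a : Tuple M σ => pair a (fun j : Fin 0 => j.elim0)) (by
      rintro (i | j)
      · exact Or.inl ⟨i, rfl, fun _ => rfl⟩
      · exact j.elim0)
    convert this using 1
    ext a
    refine ⟨fun ⟨b, hb⟩ => ?_, fun h => ⟨_, h⟩⟩
    rw [Set.mem_preimage, Subsingleton.elim (fun j : Fin 0 => j.elim0) b]
    exact hb
  | succ m ih =>
    -- The first variable of the second block is moved to the first block, where it can be
    -- quantified separately.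
    have h1 := hD.preimage
      (fun a : Tuple M (Sum.elim (extend (τ 0) σ) fun j : Fin m => τ j.succ) =>
        pair (fun i => a (Sum.inl (some i)))
          (Fin.cons (α := fun j => M (τ j)) (a (Sum.inl none)) fun j : Fin m => a (Sum.inr j))) (by
      rintro (i | j)
      · exact Or.inl ⟨Sum.inl (some i), rfl, fun _ => rfl⟩
      · induction j using Fin.cases with
        | zero => exact Or.inl ⟨Sum.inl none, rfl, fun _ => rfl⟩
        | succ j => exact Or.inl ⟨Sum.inr j, rfl, fun _ => rfl⟩)
    convert (ih h1).exists_extend using 1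
    ext a
    constructor
    · rintro ⟨b, hb⟩
      refine ⟨b 0, fun j => b j.succ, ?_⟩
      have h2 : pair a (Fin.cons (α := fun j => M (τ j)) (b 0) fun j : Fin m => b j.succ) ∈ D := by
        convert hb
        exact Fin.cons_self_tail b
      exact h2
    · rintro ⟨c, b, hb⟩
      exact ⟨_, hb⟩

end Definability

end MSLanguage

namespace MSLanguage

variable {L : MSLanguage.{u, v, w}} {M : L.Sorts → Type x}

/-! Saturation. -/

/-- Sets of parameters over which types are realized in a saturated structure. -/
def IsSmall (B : Set (Σ s, M s)) : Prop := #B < #(Σ s, M s) ∨ Finite (Σ s, M s)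

theorem isSmall_of_finite {B : Set (Σ s, M s)} (hB : B.Finite) : IsSmall B := by
  rcases finite_or_infinite (Σ s, M s) with h | h
  · exact Or.inr h
  · exact Or.inl (hB.lt_aleph0.trans_le (aleph0_le_mk _))

theorem IsSmall.union {B C : Set (Σ s, M s)} (hB : IsSmall B) (hC : IsSmall C) :
    IsSmall (B ∪ C) := by
  rcases finite_or_infinite (Σ s, M s) with h | h
  · exact Or.inr h
  · have h' : ¬ Finite (Σ s, M s) := not_finite_iff_infinite.2 h
    exact Or.inl ((mk_union_le B C).trans_lt
      (add_lt_of_lt (aleph0_le_mk _) (hB.resolve_right h') (hC.resolve_right h')))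

theorem exists_subset_of_finite {α : Type*} {𝒟 : Set (Set α)} (hne : 𝒟.Nonempty)
    (hdir : DirectedOn (fun C D => D ⊆ C) 𝒟) {Δ : Set (Set α)} (hΔ : Δ.Finite) (hsub : Δ ⊆ 𝒟) :
    ∃ D ∈ 𝒟, ∀ C ∈ Δ, D ⊆ C := by
  induction Δ, hΔ using Set.Finite.induction_on with
  | empty => exact ⟨hne.some, hne.some_mem, by simp⟩
  | insert _ _ ih =>
    obtain ⟨D, hD, hDC⟩ := ih ((Set.subset_insert _ _).trans hsub)
    obtain ⟨D', hD', h1, h2⟩ := hdir _ hD _ (hsub (Set.mem_insert _ _))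
    refine ⟨D', hD', ?_⟩
    rintro C (rfl | hC)
    exacts [h2, h1.trans (hDC C hC)]

/-- The inverse of a set of pairs. -/
def pairsInv (G : Set (Σ s, M s × M s)) : Set (Σ s, M s × M s) := {x | ⟨x.1, x.2.swap⟩ ∈ G}

theorem pairsInv_insert (G : Set (Σ s, M s × M s)) (x : Σ s, M s × M s) :
    pairsInv (insert x G) = insert ⟨x.1, x.2.swap⟩ (pairsInv G) := by
  obtain ⟨s, c, d⟩ := x
  ext ⟨s', c', d'⟩
  simp only [pairsInv, Set.mem_ofPred_eq, Set.mem_insert_iff, Prod.swap_prod_mk, Sigma.mk.injEq]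
  refine or_congr (and_congr_right ?_) Iff.rfl
  rintro rfl
  simp only [heq_eq_eq, Prod.mk.injEq, and_comm]

variable [L.Structure M] {A B : Set (Σ s, M s)} {ι κ : Type} {σ : ι → L.Sorts} {τ : κ → L.Sorts}

/-- Saturation for directed families of definable sets. A finite model needs no bound on the
parameters: if every point were excluded by some member, one member would avoid all of these
finitely many points. -/
theorem IsSaturated.exists_mem_one (hM : IsSaturated M) (hB : IsSmall B) {s : L.Sorts}
    {𝒟 : Set (Set (Tuple M fun _ : Unit => s))} (hne : 𝒟.Nonempty)
    (hdir : DirectedOn (fun C D => D ⊆ C) 𝒟) (hdef : ∀ D ∈ 𝒟, IsDefinable B D)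
    (h𝒟 : ∀ D ∈ 𝒟, D.Nonempty) : ∃ a, ∀ D ∈ 𝒟, a ∈ D := by
  rcases hB with hB | hB
  · have := hM B hB s {φ | {a | φ.Holds a} ∈ 𝒟} (by
      intro Δ hΔ hsub
      obtain ⟨D, hD, hDC⟩ := exists_subset_of_finite hne hdir
        (hΔ.image fun φ => {a | φ.Holds a}) (by rintro _ ⟨φ, hφ, rfl⟩; exact hsub hφ)
      obtain ⟨a, ha⟩ := h𝒟 D hD
      exact ⟨a, fun φ hφ => hDC _ ⟨φ, hφ, rfl⟩ ha⟩)
    obtain ⟨a, ha⟩ := this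
    refine ⟨a, fun D hD => ?_⟩
    obtain ⟨φ, hφ⟩ := hdef D hD
    have hD' : D = {a | φ.Holds a} := Set.ext hφ
    exact (hφ a).2 (ha φ (hD' ▸ hD : {a | φ.Holds a} ∈ 𝒟))
  · by_contra! hcon
    choose F hF hF' using hcon
    have : Finite (M s) := Finite.of_injective (fun c => (⟨s, c⟩ : Σ s, M s)) sigma_mk_injective
    obtain ⟨D, hD, hDC⟩ := exists_subset_of_finite hne hdir (Set.finite_range F)
      (by rintro _ ⟨a, rfl⟩; exact hF a)
    obtain ⟨a, ha⟩ := h𝒟 D hD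
    exact hF' a (hDC _ ⟨a, rfl⟩ ha)

theorem directedOn_image {α β : Type*} {𝒟 : Set (Set α)} (hdir : DirectedOn (fun C D => D ⊆ C) 𝒟)
    {F : Set α → Set β} (hF : Monotone F) : DirectedOn (fun C D => D ⊆ C) (F '' 𝒟) := by
  rintro _ ⟨C, hC, rfl⟩ _ ⟨D, hD, rfl⟩
  obtain ⟨E, hE, h1, h2⟩ := hdir C hC D hD
  exact ⟨_, ⟨E, hE, rfl⟩, hF h1, hF h2⟩

/-- Realize the projections to the first coordinate, then add that coordinate to the parameters and
treat the remaining ones. The parameter set stays small. -/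
theorem IsSaturated.exists_mem (hM : IsSaturated M) (hB : IsSmall B) {n : ℕ} {σ : Fin n → L.Sorts}
    {𝒟 : Set (Set (Tuple M σ))} (hne : 𝒟.Nonempty)
    (hdir : DirectedOn (fun C D => D ⊆ C) 𝒟) (hdef : ∀ D ∈ 𝒟, IsDefinable B D)
    (h𝒟 : ∀ D ∈ 𝒟, D.Nonempty) : ∃ a, ∀ D ∈ 𝒟, a ∈ D := by
  induction n generalizing B with
  | zero =>
    refine ⟨fun j => j.elim0, fun D hD => ?_⟩
    obtain ⟨a, ha⟩ := h𝒟 D hD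
    rwa [Subsingleton.elim (fun j : Fin 0 => j.elim0) a]
  | succ n ih =>
    let F : Set (Tuple M σ) → Set (Tuple M fun _ : Unit => σ 0) := fun D =>
      {c | ∃ b : Tuple M fun j : Fin n => σ j.succ, (Fin.cons (c ()) b : Tuple M σ) ∈ D}
    obtain ⟨c, hc⟩ := hM.exists_mem_one hB (hne.image F)
      (directedOn_image hdir fun C D h c ⟨b, hb⟩ => ⟨b, h hb⟩)
      (by
        rintro _ ⟨D, hD, rfl⟩
        refine ((hdef D hD).preimage (fun a : Tuple M (Sum.elim (fun _ : Unit => σ 0)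
          fun j : Fin n => σ j.succ) => Fin.cons (α := fun j => M (σ j)) (a (Sum.inl ()))
            fun j : Fin n => a (Sum.inr j)) fun j => ?_).exists_pair
        induction j using Fin.cases with
        | zero => exact Or.inl ⟨Sum.inl (), rfl, fun _ => rfl⟩
        | succ j => exact Or.inl ⟨Sum.inr j, rfl, fun _ => rfl⟩)
      (by
        rintro _ ⟨D, hD, rfl⟩
        obtain ⟨a, ha⟩ := h𝒟 D hD
        exact ⟨fun _ => a 0, fun j => a j.succ, (Fin.cons_self_tail a).symm ▸ ha⟩)
    let G : Set (Tuple M σ) → Set (Tuple M fun j : Fin n => σ j.succ) := fun D =>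
      {b | (Fin.cons (c ()) b : Tuple M σ) ∈ D}
    obtain ⟨b, hb⟩ := ih (B := B ∪ {⟨σ 0, c ()⟩})
      (hB.union (isSmall_of_finite (Set.finite_singleton _))) (hne.image G)
      (directedOn_image hdir fun C D h c hc => h hc)
      (by
        rintro _ ⟨D, hD, rfl⟩
        refine ((hdef D hD).mono Set.subset_union_left).preimage
          (fun b : Tuple M fun j : Fin n => σ j.succ => Fin.cons (α := fun j => M (σ j)) (c ()) b)
          fun j => ?_
        induction j using Fin.cases with
        | zero => exact Or.inr ⟨c (), Or.inr rfl, fun _ => rfl⟩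
        | succ j => exact Or.inl ⟨j, rfl, fun _ => rfl⟩)
      (by
        rintro _ ⟨D, hD, rfl⟩
        exact hc _ ⟨D, hD, rfl⟩)
    exact ⟨_, fun D hD => hb _ ⟨D, hD, rfl⟩⟩

theorem IsSaturated.exists_pair_mem (hM : IsSaturated M) (hB : IsSmall B) {n m : ℕ}
    {σ : Fin n → L.Sorts} {τ : Fin m → L.Sorts}
    {𝒟 : Set (Set (Tuple M (Sum.elim σ τ)))} (hne : 𝒟.Nonempty)
    (hdir : DirectedOn (fun C D => D ⊆ C) 𝒟) (hdef : ∀ D ∈ 𝒟, IsDefinable B D)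
    (h𝒟 : ∀ D ∈ 𝒟, D.Nonempty) : ∃ a : Tuple M σ, ∃ b : Tuple M τ, ∀ D ∈ 𝒟, pair a b ∈ D := by
  let F : Set (Tuple M (Sum.elim σ τ)) → Set (Tuple M σ) := fun D =>
    {a | ∃ b : Tuple M τ, pair a b ∈ D}
  obtain ⟨a, ha⟩ := hM.exists_mem hB (hne.image F)
    (directedOn_image hdir fun C D h c ⟨b, hb⟩ => ⟨b, h hb⟩)
    (by rintro _ ⟨D, hD, rfl⟩; exact (hdef D hD).exists_pair)
    (by
      rintro _ ⟨D, hD, rfl⟩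
      obtain ⟨v, hv⟩ := h𝒟 D hD
      refine ⟨fun i => v (Sum.inl i), fun j => v (Sum.inr j), ?_⟩
      convert hv using 1
      funext i
      cases i <;> rfl)
  let G : Set (Tuple M (Sum.elim σ τ)) → Set (Tuple M τ) := fun D => {b | pair a b ∈ D}
  obtain ⟨b, hb⟩ := hM.exists_mem (B := B ∪ Set.range fun i => ⟨σ i, a i⟩)
    (hB.union (isSmall_of_finite (Set.finite_range _))) (hne.image G)
    (directedOn_image hdir fun C D h c hc => h hc)
    (by
      rintro _ ⟨D, hD, rfl⟩
      refine ((hdef D hD).mono Set.subset_union_left).preimage (fun b => pair a b) ?_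
      rintro (i | j)
      · exact Or.inr ⟨a i, Or.inr ⟨i, rfl⟩, fun _ => rfl⟩
      · exact Or.inl ⟨j, rfl, fun _ => rfl⟩)
    (by
      rintro _ ⟨D, hD, rfl⟩
      exact ha _ ⟨D, hD, rfl⟩)
  exact ⟨a, b, fun D hD => hb _ ⟨D, hD, rfl⟩⟩

/-! Partial elementary maps and automorphisms. -/

/-- A set of pairs of elements which is (the graph of) a partial elementary map. -/
def IsElementary (G : Set (Σ s, M s × M s)) : Prop :=
  ∀ (κ : Type) [Finite κ] (τ : κ → L.Sorts) (a b : Tuple M τ),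
    (∀ i, (⟨τ i, a i, b i⟩ : Σ s, M s × M s) ∈ G) → ∀ φ : L.Formula τ, φ.Holds a ↔ φ.Holds b

theorem IsElementary.inv {G : Set (Σ s, M s × M s)} (hG : IsElementary G) :
    IsElementary (pairsInv G) :=
  fun κ _ τ a b h φ => (hG κ τ b a h φ).symm

/-- The forth step: the type of `c` over the domain is transported to the range, where it is
finitely satisfiable because `G` preserves existential formulas. -/
theorem IsElementary.exists_insert (hM : IsSaturated M) {G : Set (Σ s, M s × M s)}
    (hG : IsElementary G) (hsmall : IsSmall ((fun x => (⟨x.1, x.2.2⟩ : Σ s, M s)) '' G))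
    {s : L.Sorts} (c : M s) : ∃ d, IsElementary (insert ⟨s, c, d⟩ G) := by
  let 𝒟 : Set (Set (Tuple M fun _ : Unit => s)) := {D | ∃ (κ : Type) (_ : Finite κ)
    (τ : κ → L.Sorts) (a b : Tuple M τ) (_ : ∀ i, (⟨τ i, a i, b i⟩ : Σ s, M s × M s) ∈ G)
    (φ : L.Formula (Sum.elim (fun _ : Unit => s) τ)), φ.Holds (pair (fun _ => c) a) ∧
      D = {d | φ.Holds (pair d b)}}
  have hdir : DirectedOn (fun C D => D ⊆ C) 𝒟 := by
    rintro _ ⟨κ, _, τ, a, b, hab, φ, hφ, rfl⟩ _ ⟨κ', _, τ', a', b', hab', φ', hφ', rfl⟩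
    let ctx := Sum.elim (fun _ : Unit => s) (Sum.elim τ τ')
    let f : ∀ i, L.Term ctx (Sum.elim (fun _ : Unit => s) τ i)
      | Sum.inl _ => .var (σ := ctx) (Sum.inl ())
      | Sum.inr j => .var (σ := ctx) (Sum.inr (Sum.inl j))
    let f' : ∀ i, L.Term ctx (Sum.elim (fun _ : Unit => s) τ' i)
      | Sum.inl _ => .var (σ := ctx) (Sum.inl ())
      | Sum.inr j => .var (σ := ctx) (Sum.inr (Sum.inr j))
    have hf : ∀ (d : Tuple M fun _ : Unit => s) (a : Tuple M τ) (a' : Tuple M τ'),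
        (fun i => (f i).eval (pair d (pair a a'))) = pair d a :=
      fun d a a' => funext fun i => by cases i <;> rfl
    have hf' : ∀ (d : Tuple M fun _ : Unit => s) (a : Tuple M τ) (a' : Tuple M τ'),
        (fun i => (f' i).eval (pair d (pair a a'))) = pair d a' :=
      fun d a a' => funext fun i => by cases i <;> rfl
    refine ⟨_, ⟨κ ⊕ κ', inferInstance, Sum.elim τ τ', pair a a', pair b b', ?_,
      (φ.subst f).and (φ'.subst f'), ?_, rfl⟩, ?_, ?_⟩
    · rintro (i | i)
      exacts [hab i, hab' i]
    · rw [Formula.holds_and, Formula.holds_subst, Formula.holds_subst, hf, hf']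
      exact ⟨hφ, hφ'⟩
    · intro d hd
      rw [Set.mem_ofPred_eq, Formula.holds_and, Formula.holds_subst, hf] at hd
      exact hd.1
    · intro d hd
      rw [Set.mem_ofPred_eq, Formula.holds_and, Formula.holds_subst, Formula.holds_subst, hf'] at hd
      exact hd.2
  obtain ⟨d, hd⟩ := hM.exists_mem_one hsmall (𝒟 := 𝒟)
    ⟨_, PEmpty, inferInstance, fun i => i.elim, fun i => i.elim, fun i => i.elim, fun i => i.elim,
      Formula.falsum.not, id, rfl⟩ hdir
    (by
      rintro _ ⟨κ, _, τ, a, b, hab, φ, -, rfl⟩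
      refine isDefinable_of_finite b (fun j => ?_) φ
      exact ⟨⟨τ j, a j, b j⟩, hab j, rfl⟩)
    (by
      rintro _ ⟨κ, _, τ, a, b, hab, φ, hφ, rfl⟩
      let f : ∀ i, L.Term (extend s τ) (Sum.elim (fun _ : Unit => s) τ i)
        | Sum.inl _ => .var (σ := extend s τ) none
        | Sum.inr j => .var (σ := extend s τ) (some j)
      have hf : ∀ (d : M s) (a : Tuple M τ),
          (fun i => (f i).eval (extendTuple d a)) = pair (fun _ => d) a :=
        fun d a => funext fun i => by cases i <;> rfl
      have := (hG κ τ a b hab (φ.subst f).ex).1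
        (Formula.holds_ex.2 ⟨c, by rwa [Formula.holds_subst, hf]⟩)
      obtain ⟨d, hd⟩ := Formula.holds_ex.1 this
      rw [Formula.holds_subst, hf] at hd
      exact ⟨fun _ => d, hd⟩)
  refine ⟨d (), fun κ _ τ a b hab => ?_⟩
  -- All variables assigned the new pair are merged into one; the others, indexed by `I`, are
  -- handled by `G`.
  let I := {i // (⟨τ i, a i, b i⟩ : Σ s, M s × M s) ∈ G}
  let ctx : Unit ⊕ I → L.Sorts := Sum.elim (fun _ : Unit => s) fun i : I => τ i
  have hvar : ∀ y : Σ s, M s × M s, y = ⟨s, c, d ()⟩ → ∃ t : L.Term ctx y.1,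
      t.eval (pair (fun _ => c) fun i : I => a i) = y.2.1 ∧
      t.eval (pair d fun i : I => b i) = y.2.2 := by
    rintro _ rfl
    exact ⟨.var (σ := ctx) (Sum.inl ()), rfl, rfl⟩
  have hf : ∀ i, ∃ t : L.Term ctx (τ i), t.eval (pair (fun _ => c) fun i : I => a i) = a i ∧
      t.eval (pair d fun i : I => b i) = b i := by
    intro i
    rcases hab i with h | h
    · exact hvar _ h
    · exact ⟨.var (σ := ctx) (Sum.inr ⟨i, h⟩), rfl, rfl⟩
  choose t ht ht' using hf
  have key : ∀ φ : L.Formula τ, φ.Holds a → φ.Holds b := by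
    intro φ hφ
    have := hd _ ⟨I, inferInstance, fun i : I => τ i, fun i : I => a i, fun i : I => b i,
      fun i => i.2, φ.subst t, by rwa [Formula.holds_subst, funext ht], rfl⟩
    rwa [Set.mem_ofPred_eq, Formula.holds_subst, funext ht'] at this
  -- The converse implication is `key` for the negation.
  exact fun φ => ⟨key φ, fun h => by_contra fun hn => key φ.not hn h⟩

end MSLanguage

/-! ### Transfinite back-and-forth. -/

namespace MSLanguage

variable {L : MSLanguage.{u, v, w}} {M : L.Sorts → Type x} [L.Structure M]

theorem IsElementary.sUnion {𝒞 : Set (Set (Σ s, M s × M s))} (hne : 𝒞.Nonempty)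
    (hdir : DirectedOn (· ⊆ ·) 𝒞) (h𝒞 : ∀ G ∈ 𝒞, IsElementary G) : IsElementary (⋃₀ 𝒞) := by
  intro κ _ τ a b hab
  obtain ⟨G, hG, hsub⟩ := hdir.exists_mem_subset_of_finite_of_subset_sUnion hne
    (Set.finite_range fun i => (⟨τ i, a i, b i⟩ : Σ s, M s × M s))
    (by rintro _ ⟨i, rfl⟩; exact hab i)
  exact h𝒞 G hG κ τ a b fun i => hsub ⟨i, rfl⟩

/-- Extending the inverse map gives `t` a preimage; extending the map then gives it an image. The
bound is on `G` itself because both domain and range must be small. -/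
theorem IsElementary.exists_back_and_forth (hM : IsSaturated M) {G : Set (Σ s, M s × M s)}
    (hG : IsElementary G) (hsmall : #G < #(Σ s, M s) ∨ Finite (Σ s, M s)) (t : Σ s, M s) :
    ∃ q : (Σ s, M s × M s) × (Σ s, M s × M s), IsElementary (insert q.1 (insert q.2 G)) ∧
      (∃ d, q.1 = ⟨t.1, t.2, d⟩) ∧ ∃ c, q.2 = ⟨t.1, c, t.2⟩ := by
  have hinv : IsSmall ((fun x => (⟨x.1, x.2.2⟩ : Σ s, M s)) '' pairsInv G) := by
    refine hsmall.imp (fun h => ?_) id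
    refine lt_of_le_of_lt (mk_le_mk_of_subset ?_)
      ((mk_image_le (f := fun x => (⟨x.1, x.2.1⟩ : Σ s, M s)) (s := G)).trans_lt h)
    rintro _ ⟨⟨s, c, d⟩, hx, rfl⟩
    exact ⟨_, hx, rfl⟩
  obtain ⟨c, hc⟩ := hG.inv.exists_insert hM hinv t.2
  replace hc := hc.inv
  rw [pairsInv_insert] at hc
  obtain ⟨d, hd⟩ := hc.exists_insert hM (s := t.1) (by
    rw [Set.image_insert_eq, Set.insert_eq]
    exact (isSmall_of_finite (Set.finite_singleton _)).union
      (hsmall.imp (fun h => mk_image_le.trans_lt h) id)) t.2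
  exact ⟨⟨⟨t.1, t.2, d⟩, ⟨t.1, c, t.2⟩⟩, hd, ⟨d, rfl⟩, c, rfl⟩

/-- A family of permutations of the sorts which preserves the formulas. -/
def IsAutomorphism (e : ∀ s, M s ≃ M s) : Prop :=
  ∀ (κ : Type) [Finite κ] (τ : κ → L.Sorts) (v : Tuple M τ) (φ : L.Formula τ),
    φ.Holds v ↔ φ.Holds fun i => e _ (v i)

theorem IsElementary.exists_automorphism_of_total {G : Set (Σ s, M s × M s)} (hG : IsElementary G)
    (hdom : ∀ s (c : M s), ∃ d, (⟨s, c, d⟩ : Σ s, M s × M s) ∈ G)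
    (hran : ∀ s (d : M s), ∃ c, (⟨s, c, d⟩ : Σ s, M s × M s) ∈ G) :
    ∃ e : ∀ s, M s ≃ M s, IsAutomorphism e ∧ ∀ x ∈ G, e x.1 x.2.1 = x.2.2 := by
  have hinj : ∀ {s} {c c' d d' : M s}, (⟨s, c, d⟩ : Σ s, M s × M s) ∈ G →
      (⟨s, c', d'⟩ : Σ s, M s × M s) ∈ G → (c = c' ↔ d = d') := by
    intro s c c' d d' h h'
    -- Preservation of the equality formula makes `G` single-valued and injective.
    exact hG Bool (fun _ => s) (fun b => cond b c c') (fun b => cond b d d')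
      (by rintro (_ | _); exacts [h', h])
      (.equal (.var (σ := fun _ : Bool => s) true) (.var (σ := fun _ : Bool => s) false))
  choose F hF using hdom
  have hbij : ∀ s, Function.Bijective (F s) := by
    refine fun s => ⟨fun c c' h => (hinj (hF s c) (hF s c')).2 h, fun d => ?_⟩
    obtain ⟨c, hc⟩ := hran s d
    exact ⟨c, (hinj (hF s c) hc).1 rfl⟩
  refine ⟨fun s => Equiv.ofBijective (F s) (hbij s), fun κ _ τ a φ => ?_, ?_⟩
  · exact hG κ τ _ _ (fun i => hF _ _) φ
  · rintro ⟨s, c, d⟩ hx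
    exact (hinj (hF s c) hx).1 rfl

theorem IsElementary.exists_automorphism (hM : IsSaturated M) {G : Set (Σ s, M s × M s)}
    (hG : IsElementary G) (hsmall : #G < #(Σ s, M s) ∨ Finite (Σ s, M s)) :
    ∃ e : ∀ s, M s ≃ M s, IsAutomorphism e ∧ ∀ x ∈ G, e x.1 x.2.1 = x.2.2 := by
  classical
  -- The model is enumerated along its initial ordinal, so that every proper initial segment has
  -- fewer elements than the model and, when the model is infinite, each intermediate map stays
  -- small.
  let W := (#(Σ s, M s)).ord.ToType
  obtain ⟨enum⟩ : Nonempty (W ≃ Σ s, M s) := Cardinal.eq.1 (mk_ord_toType _)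
  let Q := (Σ s, M s × M s) × (Σ s, M s × M s)
  have : Nonempty (W → Q) := ⟨fun t => ⟨⟨_, (enum t).2, (enum t).2⟩, ⟨_, (enum t).2, (enum t).2⟩⟩⟩
  let Good : Set (Σ s, M s × M s) → W → Q → Prop := fun H t q =>
    IsElementary (insert q.1 (insert q.2 H)) ∧
      (∃ d, q.1 = ⟨(enum t).1, (enum t).2, d⟩) ∧ ∃ c, q.2 = ⟨(enum t).1, c, (enum t).2⟩
  -- The default branch makes the recursion total; `hgood` shows that it is never taken.
  let step : Set (Σ s, M s × M s) → W → Q := fun H t =>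
    if h : ∃ q, Good H t q then h.choose else Classical.choice this t
  let F : W → Q := (wellFounded_lt (α := W)).fix fun t rec =>
    step (G ∪ {x | ∃ u, ∃ h : u < t, x = (rec u h).1 ∨ x = (rec u h).2}) t
  let Lt : W → Set (Σ s, M s × M s) := fun t => G ∪ {x | ∃ u < t, x = (F u).1 ∨ x = (F u).2}
  let Le : W → Set (Σ s, M s × M s) := fun t => G ∪ {x | ∃ u ≤ t, x = (F u).1 ∨ x = (F u).2}
  have hF : ∀ t, F t = step (Lt t) t := by
    intro t
    refine ((wellFounded_lt (α := W)).fix_eq _ t).trans ?_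
    simp only [Lt, exists_prop]
    rfl
  have hLe : ∀ t, Le t = insert (F t).1 (insert (F t).2 (Lt t)) := by
    intro t
    ext y
    simp only [Le, Lt, Set.mem_union, Set.mem_insert_iff, Set.mem_ofPred_eq, le_iff_lt_or_eq]
    constructor
    · rintro (h | ⟨u, h | rfl, h' | h'⟩)
      exacts [.inr (.inr (.inl h)), .inr (.inr (.inr ⟨u, h, .inl h'⟩)),
        .inr (.inr (.inr ⟨u, h, .inr h'⟩)), .inl h', .inr (.inl h')]
    · rintro (h | h | h | ⟨u, h, h'⟩)
      exacts [.inr ⟨t, .inr rfl, .inl h⟩, .inr ⟨t, .inr rfl, .inr h⟩, .inl h,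
        .inr ⟨u, .inl h, h'⟩]
  have hmono : ∀ {t u}, t ≤ u → Le t ⊆ Le u := by
    rintro t u htu y (h | ⟨v, hv, h⟩)
    exacts [.inl h, .inr ⟨v, hv.trans htu, h⟩]
  have hunion : ∀ S : Set W, (∀ t ∈ S, IsElementary (Le t)) →
      IsElementary (⋃₀ insert G (Le '' S)) := by
    intro S hS
    refine IsElementary.sUnion ⟨G, Set.mem_insert _ _⟩ ?_ ?_
    · rintro _ (rfl | ⟨t, ht, rfl⟩) _ (rfl | ⟨u, hu, rfl⟩)
      · exact ⟨_, Set.mem_insert _ _, subset_rfl, subset_rfl⟩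
      · exact ⟨_, .inr ⟨u, hu, rfl⟩, Set.subset_union_left, subset_rfl⟩
      · exact ⟨_, .inr ⟨t, ht, rfl⟩, subset_rfl, Set.subset_union_left⟩
      · rcases le_total t u with h | h
        · exact ⟨_, .inr ⟨u, hu, rfl⟩, hmono h, subset_rfl⟩
        · exact ⟨_, .inr ⟨t, ht, rfl⟩, subset_rfl, hmono h⟩
    · rintro _ (rfl | ⟨t, ht, rfl⟩)
      exacts [hG, hS t ht]
  have hLt : ∀ t, Lt t = ⋃₀ insert G (Le '' Set.Iio t) := by
    intro t
    ext y
    constructor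
    · rintro (h | ⟨u, hu, h⟩)
      · exact ⟨G, Set.mem_insert _ _, h⟩
      · exact ⟨_, .inr ⟨u, hu, rfl⟩, .inr ⟨u, le_rfl, h⟩⟩
    · rintro ⟨_, rfl | ⟨u, hu, rfl⟩, h⟩
      · exact .inl h
      · exact h.imp id fun ⟨v, hv, h⟩ => ⟨v, hv.trans_lt hu, h⟩
  have hLtsmall : ∀ t, #(Lt t) < #(Σ s, M s) ∨ Finite (Σ s, M s) := by
    intro t
    rcases finite_or_infinite (Σ s, M s) with h | h
    · exact .inr h
    left
    have hinf := aleph0_le_mk (Σ s, M s)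
    have hIio : #(Set.Iio t) < #(Σ s, M s) :=
      (mk_Iio_lt t (by rw [mk_ord_toType, Ordinal.type_toType])).trans_eq (mk_ord_toType _)
    have hsub : Lt t ⊆ G ∪ ((fun u => (F u).1) '' Set.Iio t ∪ (fun u => (F u).2) '' Set.Iio t) := by
      rintro y (h | ⟨u, hu, h | h⟩)
      exacts [.inl h, .inr (.inl ⟨u, hu, h.symm⟩), .inr (.inr ⟨u, hu, h.symm⟩)]
    refine (mk_le_mk_of_subset hsub).trans_lt ((mk_union_le _ _).trans_lt (add_lt_of_lt hinf
      (hsmall.resolve_right (not_finite_iff_infinite.2 h)) ((mk_union_le _ _).trans_lt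
        (add_lt_of_lt hinf (lt_of_le_of_lt ?_ hIio) (lt_of_le_of_lt ?_ hIio)))))
    all_goals
      refine mk_le_of_surjective (f := fun u : Set.Iio t => ⟨_, u, u.2, rfl⟩) ?_
      rintro ⟨_, u, hu, rfl⟩
      exact ⟨⟨u, hu⟩, rfl⟩
  have hgood : ∀ t, Good (Lt t) t (F t) := by
    intro t
    induction t using WellFoundedLT.induction with
    | ind t ih =>
      have helem : IsElementary (Lt t) := by
        rw [hLt]
        exact hunion _ fun u hu => hLe u ▸ (ih u hu).1
      have hex : ∃ q, Good (Lt t) t q := helem.exists_back_and_forth hM (hLtsmall t) (enum t)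
      have : F t = hex.choose := (hF t).trans (dif_pos hex)
      rw [this]
      exact hex.choose_spec
  obtain ⟨e, he, heG⟩ := (hunion Set.univ fun t _ => hLe t ▸ (hgood t).1).exists_automorphism_of_total
    (by
      intro s c
      obtain ⟨t, ht⟩ := enum.surjective ⟨s, c⟩
      have h := (hgood t).2.1
      rw [ht] at h
      obtain ⟨d, hd⟩ := h
      exact ⟨d, Le t, .inr ⟨t, trivial, rfl⟩, .inr ⟨t, le_rfl, .inl hd.symm⟩⟩)
    (by
      intro s c
      obtain ⟨t, ht⟩ := enum.surjective ⟨s, c⟩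
      have h := (hgood t).2.2
      rw [ht] at h
      obtain ⟨d, hd⟩ := h
      exact ⟨d, Le t, .inr ⟨t, trivial, rfl⟩, .inr ⟨t, le_rfl, .inr hd.symm⟩⟩)
  exact ⟨e, he, fun y hy => heG y ⟨G, Set.mem_insert _ _, hy⟩⟩

end MSLanguage

/-! ### Invariant relations and relative definability. -/

namespace MSLanguage

variable {L : MSLanguage.{u, v, w}} {M : L.Sorts → Type x} [L.Structure M]
  {A B : Set (Σ s, M s)} {ι κ : Type} {σ : ι → L.Sorts} {τ : κ → L.Sorts}

theorem IsDefinable.biInter {α : Type*} (s : Finset α) {D : α → Set (Tuple M σ)}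
    (hD : ∀ i, IsDefinable A (D i)) : IsDefinable A (⋂ i ∈ s, D i) := by
  classical
  induction s using Finset.induction_on with
  | empty => simpa using isDefinable_univ
  | insert a s _ ih =>
    rw [Finset.set_biInter_insert]
    exact (hD a).inter ih

/-- A set membership in which is determined by membership in finitely many definable sets is
definable. -/
theorem isDefinable_of_saturated {α : Type*} (s : Finset α) {D : α → Set (Tuple M σ)}
    (hD : ∀ i, IsDefinable A (D i)) {S : Set (Tuple M σ)}
    (hS : ∀ a b, (∀ i ∈ s, (a ∈ D i ↔ b ∈ D i)) → a ∈ S → b ∈ S) : IsDefinable A S := by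
  classical
  induction s using Finset.induction_on generalizing S with
  | empty =>
    rcases S.eq_empty_or_nonempty with rfl | ⟨a, ha⟩
    · simpa using (isDefinable_univ (A := A) (σ := σ)).compl
    · rw [Set.eq_univ_of_forall fun b => hS a b (by simp) ha]
      exact isDefinable_univ
  | insert i s _ ih =>
    -- The part of `S` inside `D i`, and likewise the part outside, agrees there with a set
    -- determined by the remaining `D j`.
    have key : ∀ T : Set (Tuple M σ),
        IsDefinable A {b | ∃ a ∈ T ∩ S, ∀ i ∈ s, (a ∈ D i ↔ b ∈ D i)} := fun T => ih (by
      rintro b c hbc ⟨a, ha, hab⟩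
      exact ⟨a, ha, fun i hi => (hab i hi).trans (hbc i hi)⟩)
    convert ((hD i).inter (key (D i))).union ((hD i).compl.inter (key (D i)ᶜ)) using 1
    ext b
    constructor
    · intro hb
      by_cases hbi : b ∈ D i
      · exact .inl ⟨hbi, b, ⟨hbi, hb⟩, fun _ _ => Iff.rfl⟩
      · exact .inr ⟨hbi, b, ⟨hbi, hb⟩, fun _ _ => Iff.rfl⟩
    · rintro (⟨hbi, a, ⟨hai, ha⟩, hab⟩ | ⟨hbi, a, ⟨hai, ha⟩, hab⟩)
      all_goals
        refine hS a b (fun j hj => ?_) ha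
        rcases Finset.mem_insert.1 hj with rfl | hj
        · first
            | exact iff_of_true hai hbi
            | exact iff_of_false hai hbi
        · exact hab j hj

theorem IsSaturated.exists_pair_mem_iInter (hM : IsSaturated M) (hB : IsSmall B) {n m : ℕ}
    {σ : Fin n → L.Sorts} {τ : Fin m → L.Sorts} {α : Type*}
    {D : α → Set (Tuple M (Sum.elim σ τ))} (hD : ∀ i, IsDefinable B (D i))
    (hne : ∀ s : Finset α, (⋂ i ∈ s, D i).Nonempty) :
    ∃ a : Tuple M σ, ∃ b : Tuple M τ, ∀ i, pair a b ∈ D i := by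
  classical
  obtain ⟨a, b, hab⟩ := hM.exists_pair_mem hB (𝒟 := Set.range fun s : Finset α => ⋂ i ∈ s, D i)
    (Set.range_nonempty _)
    (by
      rintro _ ⟨s, rfl⟩ _ ⟨t, rfl⟩
      exact ⟨_, ⟨s ∪ t, rfl⟩, Set.biInter_subset_biInter_left fun i hi => Finset.mem_union_left t hi,
        Set.biInter_subset_biInter_left fun i hi => Finset.mem_union_right s hi⟩)
    (by rintro _ ⟨s, rfl⟩; exact IsDefinable.biInter s hD)
    (by rintro _ ⟨s, rfl⟩; exact hne s)
  exact ⟨a, b, fun i => by simpa using hab _ ⟨{i}, rfl⟩⟩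

/-- The pairs fixed by a map which is the identity on `A` and sends `a` to `b`. -/
def pairsOver (A : Set (Σ s, M s)) (a b : Tuple M σ) : Set (Σ s, M s × M s) :=
  (fun y => ⟨y.1, y.2, y.2⟩) '' A ∪ Set.range fun i => ⟨σ i, a i, b i⟩

/-- Every entry of a tuple from the domain is a parameter from `A` or a coordinate of `a`.
Substituting these turns a formula about the tuple into an `A`-definable condition on `a`, which `b`
shares. -/
theorem isElementary_pairsOver [Finite ι] {a b : Tuple M σ}
    (hab : ∀ D : Set (Tuple M σ), IsDefinable A D → (a ∈ D ↔ b ∈ D)) :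
    IsElementary (pairsOver A a b) := by
  intro κ _ τ a' b' h φ
  have hg : ∀ y ∈ pairsOver A a b, ∃ g : Tuple M σ → M y.1,
      ((∃ j, ∃ h : σ j = y.1, ∀ v, g v = h ▸ v j) ∨
        ∃ c, (⟨y.1, c⟩ : Σ s, M s) ∈ A ∧ ∀ v, g v = c) ∧ g a = y.2.1 ∧ g b = y.2.2 := by
    rintro _ (⟨⟨s, c⟩, hc, rfl⟩ | ⟨i, rfl⟩)
    · exact ⟨fun _ => c, .inr ⟨c, hc, fun _ => rfl⟩, rfl, rfl⟩
    · exact ⟨fun v => v i, .inl ⟨i, rfl, fun _ => rfl⟩, rfl, rfl⟩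
  choose g hg hga hgb using fun i => hg _ (h i)
  have hdef : IsDefinable A {v : Tuple M τ | φ.Holds v} := by
    let ρ : PEmpty.{1} → L.Sorts := PEmpty.elim
    let c : Tuple M ρ := fun i => i.elim
    let f : ∀ i, L.Term (Sum.elim τ ρ) (τ i) := fun i => .var (σ := Sum.elim τ ρ) (Sum.inl i)
    have := isDefinable_of_finite (A := A) (σ := τ) c (fun i => i.elim) (φ.subst f)
    convert this using 1
    ext v
    rw [Set.mem_ofPred_eq, Set.mem_ofPred_eq, Formula.holds_subst]
    rfl
  have := hab _ (hdef.preimage (fun v i => g i v) hg)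
  simp only [Set.mem_preimage, Set.mem_ofPred_eq] at this
  rwa [funext hga, funext hgb] at this

/-! ### Automorphisms acting on the locus of a complete type. -/

section Locus

variable {n : ℕ} {σ : Fin n → L.Sorts} {p : CompleteType A σ}

theorem CompleteType.mem_iff (p : CompleteType A σ) {D : Set (Tuple M σ)} (hD : IsDefinable A D)
    (a b : p.locus) : a.1 ∈ D ↔ b.1 ∈ D := by
  obtain ⟨φ, hφ⟩ := hD
  rw [hφ, hφ]
  rcases p.complete φ with h | h
  · exact iff_of_true (a.2 φ h) (b.2 φ h)
  · exact iff_of_false (a.2 _ h) (b.2 _ h)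

/-- Permutations of the locus which preserve all relatively definable binary relations. -/
def PreservesRelDefinable (p : CompleteType A σ) (g : p.locus ≃ p.locus) : Prop :=
  ∀ R : p.locus → p.locus → Prop, IsRelDefinable₂ A R → ∀ c d, R c d ↔ R (g c) (g d)

theorem IsAutomorphism.mem_iff [Finite ι] {σ : ι → L.Sorts} {e : ∀ s, M s ≃ M s}
    (he : IsAutomorphism e) (heA : ∀ y ∈ A, e y.1 y.2 = y.2) {D : Set (Tuple M σ)}
    (hD : IsDefinable A D) (a : Tuple M σ) : a ∈ D ↔ (fun i => e _ (a i)) ∈ D := by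
  obtain ⟨φ, hφ⟩ := hD
  rw [hφ, hφ, FormulaOver.Holds, FormulaOver.Holds, he]
  refine iff_of_eq (congrArg _ (funext fun i => ?_))
  cases i with
  | inl i => rfl
  | inr j => exact heA _ (φ.param_mem j)

theorem exists_preservesRelDefinable (hM : IsSaturated M) (hA : #A < #(Σ s, M s)) [Finite ι]
    {τ : ι → L.Sorts} {a b : Tuple M τ}
    (hab : ∀ D : Set (Tuple M τ), IsDefinable A D → (a ∈ D ↔ b ∈ D)) :
    ∃ e : ∀ s, M s ≃ M s, (∀ i, e _ (a i) = b i) ∧ ∃ g : p.locus ≃ p.locus,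
      (∀ c i, (g c).1 i = e _ (c.1 i)) ∧ PreservesRelDefinable p g := by
  have hsmall : #(pairsOver A a b) < #(Σ s, M s) ∨ Finite (Σ s, M s) := by
    rcases finite_or_infinite (Σ s, M s) with h | h
    · exact .inr h
    · exact .inl ((mk_union_le _ _).trans_lt (add_lt_of_lt (aleph0_le_mk _)
        (mk_image_le.trans_lt hA)
        ((Set.finite_range _).lt_aleph0.trans_le (aleph0_le_mk _))))
  obtain ⟨e, he, heG⟩ := (isElementary_pairsOver hab).exists_automorphism hM hsmall
  have heA : ∀ y ∈ A, e y.1 y.2 = y.2 := fun y hy => heG _ (.inl ⟨y, hy, rfl⟩)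
  have hmem : ∀ {κ : Type} [Finite κ] {ρ : κ → L.Sorts} (φ : FormulaOver A ρ) (c : Tuple M ρ),
      φ.Holds c ↔ φ.Holds fun i => e _ (c i) := fun φ c =>
    he.mem_iff heA (D := {c | φ.Holds c}) ⟨φ, fun _ => Iff.rfl⟩ c
  refine ⟨e, fun i => heG _ (.inr ⟨i, rfl⟩), ⟨fun c => ⟨fun i => e _ (c.1 i), fun φ hφ =>
    (hmem φ c.1).1 (c.2 φ hφ)⟩, fun c => ⟨fun i => (e _).symm (c.1 i), fun φ hφ => (hmem φ _).2 ?_⟩,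
    fun c => Subtype.ext ?_, fun c => Subtype.ext ?_⟩, fun c i => rfl, ?_⟩
  · simpa using c.2 φ hφ
  · simp
  · simp
  · rintro R ⟨D, hD, hR⟩ c d
    rw [hR, hR, he.mem_iff heA hD]
    exact iff_of_eq (congrArg (· ∈ D) (funext fun i => by cases i <;> rfl))

theorem exists_preservesRelDefinable_apply (hM : IsSaturated M) (hA : #A < #(Σ s, M s))
    (a b : p.locus) : ∃ g : p.locus ≃ p.locus, g a = b ∧ PreservesRelDefinable p g := by
  obtain ⟨e, he, g, hg, hg'⟩ := exists_preservesRelDefinable (p := p) hM hA (a := a.1) (b := b.1)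
    fun D hD => p.mem_iff hD a b
  exact ⟨g, Subtype.ext (funext fun i => (hg a i).trans (he i)), hg'⟩

theorem exists_preservesRelDefinable_apply₂ (hM : IsSaturated M) (hA : #A < #(Σ s, M s))
    {a b a' b' : p.locus} (h : ∀ D : Set (Tuple M (Sum.elim σ σ)), IsDefinable A D →
      (pair a.1 b.1 ∈ D ↔ pair a'.1 b'.1 ∈ D)) :
    ∃ g : p.locus ≃ p.locus, g a = a' ∧ g b = b' ∧ PreservesRelDefinable p g := by
  obtain ⟨e, he, g, hg, hg'⟩ := exists_preservesRelDefinable (p := p) hM hA h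
  exact ⟨g, Subtype.ext (funext fun i => (hg a i).trans (he (Sum.inl i))),
    Subtype.ext (funext fun i => (hg b i).trans (he (Sum.inr i))), hg'⟩

/-- A relation invariant under automorphisms, one fibre of which is relatively definable over a
small set of parameters, is relatively definable. -/
theorem isRelDefinable₂_of_invariant (hM : IsSaturated M) (hA : #A < #(Σ s, M s))
    {R : p.locus → p.locus → Prop}
    (hinv : ∀ g, PreservesRelDefinable p g → ∀ c d, R c d → R (g c) (g d))
    (hB : IsSmall B) (hAB : A ⊆ B) {a : p.locus} (ha : ∀ i, (⟨σ i, a.1 i⟩ : Σ s, M s) ∈ B)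
    (hR : IsRelDefinable B {b | R a b}) : IsRelDefinable₂ A R := by
  classical
  obtain ⟨D₀, hD₀, hR⟩ := hR
  let Ψ := {D : Set (Tuple M (Sum.elim σ σ)) // IsDefinable A D}
  let fst : Tuple M (Sum.elim σ σ) → Tuple M σ := fun v i => v (Sum.inl i)
  let snd : Tuple M (Sum.elim σ σ) → Tuple M σ := fun v i => v (Sum.inr i)
  have hfst : ∀ {D : Set (Tuple M σ)}, IsDefinable B D → IsDefinable B (fst ⁻¹' D) := fun h =>
    h.preimage fst fun i => .inl ⟨Sum.inl i, rfl, fun _ => rfl⟩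
  have hsnd : ∀ {D : Set (Tuple M σ)}, IsDefinable B D → IsDefinable B (snd ⁻¹' D) := fun h =>
    h.preimage snd fun i => .inl ⟨Sum.inr i, rfl, fun _ => rfl⟩
  have hfibre : ∀ D : Ψ, IsDefinable B {b : Tuple M σ | pair a.1 b ∈ D.1} := fun D =>
    (D.2.mono hAB).preimage (fun b => pair a.1 b) (by
      rintro (i | i)
      · exact .inr ⟨a.1 i, ha i, fun _ => rfl⟩
      · exact .inl ⟨i, rfl, fun _ => rfl⟩)
  -- Compactness: finitely many `A`-definable sets decide `R a`. Otherwise saturation yields `b` and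
  -- `c` in the locus with the same type over `A` and `a`, on which `R a` differs; an automorphism
  -- fixing `a` and taking `b` to `c` contradicts invariance.
  obtain ⟨s, hs⟩ : ∃ s : Finset Ψ, ∀ b c : p.locus,
      (∀ D ∈ s, (pair a.1 b.1 ∈ D.1 ↔ pair a.1 c.1 ∈ D.1)) → R a b → R a c := by
    by_contra! hcon
    let F : Ψ ⊕ {φ // φ ∈ p.carrier} → Set (Tuple M (Sum.elim σ σ))
      | Sum.inl D => {v | fst v ∈ D₀ ∧ snd v ∉ D₀ ∧ (pair a.1 (fst v) ∈ D.1 ↔ pair a.1 (snd v) ∈ D.1)}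
      | Sum.inr φ => {v | φ.1.Holds (fst v) ∧ φ.1.Holds (snd v)}
    have hF : ∀ i, IsDefinable B (F i) := by
      rintro (D | φ)
      · have h1 := hfst (hfibre D)
        have h2 := hsnd (hfibre D)
        convert (hfst hD₀).inter ((hsnd hD₀).compl.inter
          ((h1.inter h2).union (h1.compl.inter h2.compl))) using 1
        ext v
        simp only [F, Set.mem_ofPred_eq, Set.mem_inter_iff, Set.mem_union, Set.mem_compl_iff,
          Set.mem_preimage]
        tauto
      · have hφ : IsDefinable B {b | φ.1.Holds b} :=
          IsDefinable.mono hAB ⟨φ.1, fun _ => Iff.rfl⟩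
        exact (hfst hφ).inter (hsnd hφ)
    obtain ⟨b, c, hbc⟩ := hM.exists_pair_mem_iInter hB hF (by
      intro t
      obtain ⟨b, c, hbc, hb, hc⟩ := hcon t.toLeft
      refine ⟨pair b.1 c.1, Set.mem_iInter₂.2 ?_⟩
      rintro (D | φ) hmem
      · exact ⟨(hR b).1 hb, fun h => hc ((hR c).2 h), hbc D (Finset.mem_toLeft.2 hmem)⟩
      · exact ⟨b.2 φ.1 φ.2, c.2 φ.1 φ.2⟩)
    let b' : p.locus := ⟨b, fun φ hφ => (hbc (Sum.inr ⟨φ, hφ⟩)).1⟩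
    let c' : p.locus := ⟨c, fun φ hφ => (hbc (Sum.inr ⟨φ, hφ⟩)).2⟩
    obtain ⟨g, hga, hgb, hg⟩ := exists_preservesRelDefinable_apply₂ hM hA (p := p) (a := a)
      (b := b') (a' := a) (b' := c') fun D hD => (hbc (Sum.inl ⟨D, hD⟩)).2.2
    have hu := hbc (Sum.inl ⟨Set.univ, isDefinable_univ⟩)
    have hab : R a b' := (hR b').2 hu.1
    have hac : ¬ R a c' := fun h => hu.2.1 ((hR c').1 h)
    have := hinv g hg a b' hab
    rw [hga, hgb] at this
    exact hac this
  -- The union of those cells of the finite partition that meet the fibre of `R` over `a`. It is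
  -- `A`-definable and has the right fibre at `a`, hence at every point by transitivity.
  let S : Set (Tuple M (Sum.elim σ σ)) :=
    {v | ∃ b : p.locus, R a b ∧ ∀ D ∈ s, (pair a.1 b.1 ∈ D.1 ↔ v ∈ D.1)}
  have hS : IsDefinable A S := isDefinable_of_saturated s (fun D : Ψ => D.2) (by
    rintro v w hvw ⟨b, hb, hbv⟩
    exact ⟨b, hb, fun D hD => (hbv D hD).trans (hvw D hD)⟩)
  have hSa : ∀ c, R a c ↔ pair a.1 c.1 ∈ S := fun c =>
    ⟨fun h => ⟨c, h, fun _ _ => Iff.rfl⟩, fun ⟨b, hb, h⟩ => hs b c h hb⟩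
  have hpres : ∀ g, PreservesRelDefinable p g → ∀ c d,
      (pair c.1 d.1 ∈ S ↔ pair (g c).1 (g d).1 ∈ S) := fun g hg c d =>
    hg (fun c d => pair c.1 d.1 ∈ S) ⟨S, hS, fun _ _ => Iff.rfl⟩ c d
  refine ⟨S, hS, fun c d => ?_⟩
  constructor
  · intro h
    obtain ⟨g, hgc, hg⟩ := exists_preservesRelDefinable_apply hM hA c a
    have := hinv g hg c d h
    rwa [hgc, hSa, ← hgc, ← hpres g hg] at this
  · obtain ⟨g, rfl, hg⟩ := exists_preservesRelDefinable_apply hM hA a c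
    obtain ⟨d, rfl⟩ := g.surjective d
    rw [← hpres g hg, ← hSa]
    exact hinv g hg a d

theorem isRelDefinable₂_fibre {n : ℕ} {ρ : Fin n → L.Sorts} {P : Set (Tuple M ρ)}
    {R : P → P → Prop} (hR : IsRelDefinable₂ A R) (hAB : A ⊆ B) {a : P}
    (ha : ∀ i, (⟨ρ i, a.1 i⟩ : Σ s, M s) ∈ B) : IsRelDefinable B {b | R a b} := by
  obtain ⟨D, hD, hR⟩ := hR
  refine ⟨_, (hD.mono hAB).preimage (fun b => pair a.1 b) ?_, fun b => hR a b⟩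
  rintro (i | i)
  · exact .inr ⟨a.1 i, ha i, fun _ => rfl⟩
  · exact .inl ⟨i, rfl, fun _ => rfl⟩

end Locus

end MSLanguage

/-! ### The locus of a weakly o-minimal pair is homogeneous. -/

namespace MSLanguage

variable {L : MSLanguage.{u, v, w}} {M : L.Sorts → Type x} [L.Structure M] {A : Set (Σ s, M s)}

theorem isHomogeneousFamily_isRelDefinable₂ (hM : IsSaturated M) (hA : #A < #(Σ s, M s)) {n : ℕ}
    {σ : Fin n → L.Sorts} (p : CompleteType A σ) [LinearOrder p.locus]
    (hp : IsWeaklyOMinimalPair p) :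
    IsHomogeneousFamily {R : p.locus → p.locus → Prop | IsRelDefinable₂ A R} := by
  have hnot : ∀ {R : p.locus → p.locus → Prop}, IsRelDefinable₂ A R →
      IsRelDefinable₂ A fun a b => ¬ R a b := fun ⟨D, hD, hR⟩ =>
    ⟨Dᶜ, hD.compl, fun a b => not_congr (hR a b)⟩
  have hfin : ∀ {R : p.locus → p.locus → Prop}, IsRelDefinable₂ A R →
      ∀ a, (convexComponents {b | R a b}).Finite := fun hR a =>
    hp.2 _ (isRelDefinable₂_fibre hR (Set.subset_univ A) fun _ => Set.mem_univ _)
  have htrue : IsRelDefinable₂ A fun _ _ : p.locus => True :=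
    ⟨Set.univ, isDefinable_univ, fun _ _ => Iff.rfl⟩
  -- An invariant relation with one fibre definable from `a` and an extra point `s` is relatively
  -- `A`-definable. The bound relations are treated this way, `s` being the point that cuts off
  -- their fibre over `a`.
  have hinv : ∀ {R : p.locus → p.locus → Prop}, (∀ g, PreservesRelDefinable p g →
      ∀ c d, R c d → R (g c) (g d)) → ∀ a s : p.locus,
      (∃ D₁ D₂ : p.locus → p.locus → Prop, IsRelDefinable₂ A D₁ ∧ IsRelDefinable₂ A D₂ ∧
        ∀ b, R a b ↔ D₁ s b ∧ D₂ a b) → IsRelDefinable₂ A R := by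
    rintro R hR a s ⟨D₁, D₂, hD₁, hD₂, h⟩
    have hAB : A ⊆ A ∪ (Set.range (fun i => ⟨σ i, a.1 i⟩) ∪ Set.range fun i => ⟨σ i, s.1 i⟩) :=
      Set.subset_union_left
    obtain ⟨S₁, hS₁, h₁⟩ := isRelDefinable₂_fibre hD₁ hAB (a := s) fun i => .inr (.inr ⟨i, rfl⟩)
    obtain ⟨S₂, hS₂, h₂⟩ := isRelDefinable₂_fibre hD₂ hAB (a := a) fun i => .inr (.inl ⟨i, rfl⟩)
    refine isRelDefinable₂_of_invariant hM hA hR (a := a) (IsSmall.union (.inl hA)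
      ((isSmall_of_finite (Set.finite_range _)).union (isSmall_of_finite (Set.finite_range _))))
      hAB (fun i => .inr (.inl ⟨i, rfl⟩)) ⟨S₁ ∩ S₂, hS₁.inter hS₂, fun b => ?_⟩
    exact (h b).trans (and_congr (h₁ b) (h₂ b))
  refine ⟨hnot, ?_, ?_, hp.1, ?_, ?_, hfin, fun a b => ?_⟩
  · rintro R S ⟨D, hD, hR⟩ ⟨D', hD', hS⟩
    exact ⟨D ∩ D', hD.inter hD', fun a b => and_congr (hR a b) (hS a b)⟩
  · rintro R ⟨D, hD, hR⟩
    refine ⟨_, hD.preimage (fun v : Tuple M (Sum.elim σ σ) =>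
      pair (fun i => v (Sum.inr i)) fun i => v (Sum.inl i)) ?_, fun a b => hR b a⟩
    rintro (i | i)
    exacts [.inl ⟨Sum.inr i, rfl, fun _ => rfl⟩, .inl ⟨Sum.inl i, rfl, fun _ => rfl⟩]
  · intro R hR
    rcases isEmpty_or_nonempty p.locus with he | ⟨⟨a⟩⟩
    · exact ⟨Set.univ, isDefinable_univ, fun a => he.elim a⟩
    have hpres : ∀ g, PreservesRelDefinable p g → ∀ c d, (∀ b, R c b → b < d) →
        ∀ b, R (g c) b → b < g d := by
      intro g hg c d h b hb
      obtain ⟨b, rfl⟩ := g.surjective b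
      exact (hg _ hp.1 b d).1 (h b ((hg R hR c b).2 hb))
    rcases strictUpperBounds_eq (hfin hR a) with h | ⟨s, h⟩
    · exact hinv hpres a a ⟨_, _, htrue, htrue, fun b => iff_of_true (h b) ⟨trivial, trivial⟩⟩
    · exact hinv hpres a s ⟨_, _, hp.1, hnot hR, h⟩
  · intro R hR
    rcases isEmpty_or_nonempty p.locus with he | ⟨⟨a⟩⟩
    · exact ⟨Set.univ, isDefinable_univ, fun a => he.elim a⟩
    have hpres : ∀ g, PreservesRelDefinable p g → ∀ c d, (∀ b, R c b → d < b) →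
        ∀ b, R (g c) b → g d < b := by
      intro g hg c d h b hb
      obtain ⟨b, rfl⟩ := g.surjective b
      exact (hg _ hp.1 d b).1 (h b ((hg R hR c b).2 hb))
    rcases strictLowerBounds_eq (hfin hR a) with h | ⟨s, h⟩
    · exact hinv hpres a a ⟨_, _, htrue, htrue, fun b => iff_of_true (h b) ⟨trivial, trivial⟩⟩
    · obtain ⟨D, hD, hlt⟩ := hp.1
      refine hinv hpres a s ⟨fun a b => b < a, _, ⟨_, hD.preimage
        (fun v : Tuple M (Sum.elim σ σ) => pair (fun i => v (Sum.inr i)) fun i => v (Sum.inl i)) ?_,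
        fun a b => hlt b a⟩, hnot hR, h⟩
      rintro (i | i)
      exacts [.inl ⟨Sum.inr i, rfl, fun _ => rfl⟩, .inl ⟨Sum.inl i, rfl, fun _ => rfl⟩]
  · obtain ⟨g, hga, hg⟩ := exists_preservesRelDefinable_apply hM hA a b
    exact ⟨g, hga, hg⟩

/-- The values of `f` can be quantified out because `D` is genuinely definable, and for arguments in
`P` the graph determines the value within `D`. -/
theorem isRelDefinable₂_lt_comp {n m : ℕ} {σ : Fin n → L.Sorts} {τ : Fin m → L.Sorts}
    {P : Set (Tuple M σ)} {D : Set (Tuple M τ)} (hD : IsDefinable A D) [LinearOrder D]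
    (hlt : IsRelDefinable₂ A (fun a b : D => a < b)) {f : P → D}
    (hf : IsRelDefinable₂ A (fun (a : P) (b : D) => f a = b)) :
    IsRelDefinable₂ A fun a b : P => f a < f b := by
  obtain ⟨Λ, hΛ, hlt⟩ := hlt
  obtain ⟨Γ, hΓ, hf⟩ := hf
  let fst (v : Tuple M (Sum.elim (Sum.elim (Sum.elim σ σ) τ) τ)) : Tuple M σ :=
    fun i => v (Sum.inl (Sum.inl (Sum.inl i)))
  let snd (v : Tuple M (Sum.elim (Sum.elim (Sum.elim σ σ) τ) τ)) : Tuple M σ :=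
    fun i => v (Sum.inl (Sum.inl (Sum.inr i)))
  let left (v : Tuple M (Sum.elim (Sum.elim (Sum.elim σ σ) τ) τ)) : Tuple M τ :=
    fun i => v (Sum.inl (Sum.inr i))
  let right (v : Tuple M (Sum.elim (Sum.elim (Sum.elim σ σ) τ) τ)) : Tuple M τ :=
    fun i => v (Sum.inr i)
  have h1 := hD.preimage left fun i => .inl ⟨Sum.inl (Sum.inr i), rfl, fun _ => rfl⟩
  have h2 := hD.preimage right fun i => .inl ⟨Sum.inr i, rfl, fun _ => rfl⟩
  have h3 := hΓ.preimage (fun v => pair (fst v) (left v)) (by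
    rintro (i | i)
    exacts [.inl ⟨Sum.inl (Sum.inl (Sum.inl i)), rfl, fun _ => rfl⟩,
      .inl ⟨Sum.inl (Sum.inr i), rfl, fun _ => rfl⟩])
  have h4 := hΓ.preimage (fun v => pair (snd v) (right v)) (by
    rintro (i | i)
    exacts [.inl ⟨Sum.inl (Sum.inl (Sum.inr i)), rfl, fun _ => rfl⟩,
      .inl ⟨Sum.inr i, rfl, fun _ => rfl⟩])
  have h5 := hΛ.preimage (fun v => pair (left v) (right v)) (by
    rintro (i | i)
    exacts [.inl ⟨Sum.inl (Sum.inr i), rfl, fun _ => rfl⟩, .inl ⟨Sum.inr i, rfl, fun _ => rfl⟩])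
  refine ⟨_, (h1.inter (h2.inter (h3.inter (h4.inter h5)))).exists_pair.exists_pair, fun a b => ?_⟩
  constructor
  · intro hab
    exact ⟨(f a).1, (f b).1, (f a).2, (f b).2, (hf a (f a)).1 rfl, (hf b (f b)).1 rfl,
      (hlt _ _).1 hab⟩
  · rintro ⟨c, d, hc, hd, hac, hbd, hcd⟩
    rw [(hf a ⟨c, hc⟩).2 hac, (hf b ⟨d, hd⟩).2 hbd]
    exact (hlt ⟨c, hc⟩ ⟨d, hd⟩).2 hcd

end MSLanguage

theorem theorem2 {L : MSLanguage.{u, v, w}} {M : L.Sorts → Type x} [L.Structure M]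
    (hM : MSLanguage.IsSaturated M)
    {A : Set (Σ s, M s)} (hA : #A < #(Σ s, M s))
    {n : ℕ} {σ : Fin n → L.Sorts} (p : MSLanguage.CompleteType A σ)
    [LinearOrder p.locus] (hp : MSLanguage.IsWeaklyOMinimalPair p)
    {m : ℕ} {τ : Fin m → L.Sorts} (D : Set (MSLanguage.Tuple M τ))
    (hD : MSLanguage.IsDefinable A D)
    [LinearOrder D] (hlt : MSLanguage.IsRelDefinable₂ A (fun a b : D => a < b))
    (f : p.locus → D) (hf : MSLanguage.IsRelDefinable₂ A (fun (a : p.locus) (b : D) => f a = b))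
    (hconst : ∃ a b : p.locus, f a ≠ f b) :
    -- Local monotonicity
    (∃ E : Setoid p.locus,
      MSLanguage.IsRelDefinable₂ A (fun a b : p.locus => E a b) ∧ IsConvexEquiv E ∧ E ≠ ⊥ ∧
      ∀ a : p.locus,
        (∀ b c : p.locus, E a b → E a c → f b = f c) ∨
        StrictMonoOn f {b | E a b} ∨ StrictAntiOn f {b | E a b}) ∧
    -- Upper monotonicity, with the induced map on the quotients
    (∃ E : Setoid p.locus,
      MSLanguage.IsRelDefinable₂ A (fun a b : p.locus => E a b) ∧ IsConvexEquiv E ∧ E ≠ ⊤ ∧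
      ∃ F : Setoid (Set.range f), (∀ y z, F y z ↔ imageRel f E y z) ∧ IsConvexEquiv F ∧
      ∃ fE : Quotient E → Quotient F,
        (∀ a, fE (Quotient.mk E a) = Quotient.mk F ⟨f a, Set.mem_range_self a⟩) ∧
        (((∀ a b, ClassLT E (Quotient.mk E a) (Quotient.mk E b) → f a < f b) ∧
            (∀ C C', ClassLT E C C' → ClassLT F (fE C) (fE C'))) ∨
          ((∀ a b, ClassLT E (Quotient.mk E a) (Quotient.mk E b) → f b < f a) ∧
            (∀ C C', ClassLT E C C' → ClassLT F (fE C') (fE C))))) := by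
  have h := MSLanguage.isHomogeneousFamily_isRelDefinable₂ hM hA p hp
  have hlt' := MSLanguage.isRelDefinable₂_lt_comp hD hlt hf
  have : Nontrivial p.locus := by
    obtain ⟨a, b, hab⟩ := hconst
    exact ⟨a, b, fun h => hab (h ▸ rfl)⟩
  obtain ⟨E, hEmem, hconv, hne, hmono⟩ := h.upper_monotonicity hlt' hconst
  exact ⟨h.local_monotonicity hlt', E, hEmem, hconv, hne, exists_quotient_map hconv hmono⟩
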